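/- Let $0<q<1$ and let $\mathcal A=\mathcal O(SU_q(2))$ be the Hopf $*$-algebra over $\mathbb C$ with generators $a,b,c,d$, relations $ab=qba$, $ac=qca$, $bd=qdb$, $cd=qdc$, $bc=cb$, $ad=1+qcb$, $da=1+q^{-1}bc$, the usual coproduct $\Delta$, counit $\varepsilon$ and antipode $S$ of the matrix $\begin{pmatrix}a&b\\c&d\end{pmatrix}$, and the involution $a^*=d$, $b^*=-qc$, $c^*=-q^{-1}b$, $d^*=a$. For $g$ in $U_q(\mathfrak{sl}(2))$, with generators $k^{\pm1},e,f$ and $\Delta(k)=k\otimes k$, $\Delta(e)=e\otimes k+k^{-1}\otimes e$, $\Delta(f)=f\otimes k+k^{-1}\otimes f$, let $\partial_g(x)=g\triangleright x=x_{(1)}\langle g,x_{(2)}\rangle$ be the left action on $\mathcal A$ given by the dual pairing, where $\langle k,a\rangle=q^{-1/2}$, $\langle k,d\rangle=q^{1/2}$, $\langle e,c\rangle=\langle f,b\rangle=1$ and the other pairings of $k,e,f$ with $a,b,c,d$ are $0$. Put $\sigma_L(x)=k^{-2}\triangleright x$. Let $\mathcal H_h$ be the GNS space of the Haar state $h$ of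 $\mathcal A$, with scalar product $(x,y)=h(x^*y)$, on which $\mathcal A$ acts by left multiplication, and consider on $\mathcal H_h\oplus\mathcal H_h$ the operator, defined on the dense subspace $\mathcal A\oplus\mathcal A$, $$D_q=\begin{pmatrix}(q^{-1}-q)^{-1}(q\,\partial_{k^{-2}}-1)& q^{-1/2}\partial_e\partial_{k^{-1}}\\ q^{1/2}\partial_f\partial_{k^{-1}}&(q^{-1}-q)^{-1}(1-q^{-1}\partial_{k^{-2}})\end{pmatrix}.$$ For $x\in\mathcal A$ the twisted commutator $[D_q,x]_{\sigma_L}=D_qx-\sigma_L(x)D_q$ extends to a bounded operator. Let $\Omega^1_{D_q}$ be the linear span of the operators $a\cdot[D_q,b]_{\sigma_L}:=\sigma_L(a)[D_q,b]_{\sigma_L}$, $a,b\in\mathcal A$, with the bimodule structure $a\cdot T\cdot c=\sigma_L(a)\,T\,c$ and the differential $d_{\sigma_L}(a)=[D_q,a]_{\sigma_L}$; this is a first-order differential calculus over $\mathcal A$. Let $\Gamma_{10}$ (number 10 in Heckenberger's list of left-covariant differential calculi on $SU_q(2)$) be the free left $\mathcal A$-module with basis $\omega_0,\omega_1,\omega_2$,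 with right multiplication and differential $$\omega_i\,x=(k^2\triangleright x)\,\omega_i,\qquad dx=((k^2-1)\triangleright x)\,\omega_0+(ek\triangleright x)\,\omega_1+(fk\triangleright x)\,\omega_2\qquad(x\in\mathcal A).$$ **Proposition.** $\Gamma_{10}$ is a left-covariant first-order differential calculus over $\mathcal A$, and its quantum tangent space $\{X\in\mathcal A' : X(1)=0,\ X(x)=0 \text{ whenever } \varepsilon(x)=0 \text{ and } S(x_{(1)})\,dx_{(2)}=0\}$ is the three-dimensional space spanned by $k^2-1$, $ek$, $fk$. The calculus $(\Omega^1_{D_q},d_{\sigma_L})$ implemented by $D_q$ is left-covariant and is isomorphic to $\Gamma_{10}$: there is a bijective $\mathcal A$-bimodule map $\Omega^1_{D_q}\to\Gamma_{10}$ that intertwines the differentials. -/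

import Mathlib

open scoped TensorProduct

noncomputable section

namespace QuantumSU2

/-- The deformation parameter `0 < q < 1`. -/
abbrev Param : Type := Set.Ioo (0 : ℝ) 1

/-- The number `q` as a complex scalar. -/
def qc (q : Param) : ℂ := ((q : ℝ) : ℂ)

/-- The positive square root `q^{1/2}` as a complex scalar. -/
def qh (q : Param) : ℂ := ((Real.sqrt (q : ℝ) : ℝ) : ℂ)

theorem qc_ne_zero (q : Param) : qc q ≠ 0 := by
  have h := q.2.1
  simp only [qc, ne_eq, Complex.ofReal_eq_zero]
  exact h.ne'

theorem qh_sq (q : Param) : qh q * qh q = qc q := by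
  rw [qh, qc, ← Complex.ofReal_mul, Real.mul_self_sqrt q.2.1.le]

theorem qh_ne_zero (q : Param) : qh q ≠ 0 := by
  intro h
  apply qc_ne_zero q
  rw [← qh_sq, h, mul_zero]

/-! ### The coordinate algebra -/

/-- The four generators of the coordinate algebra. -/
inductive Gen : Type
  | a | b | c | d

/-- Four elements of a complex algebra satisfy the defining relations of `SU_q(2)`. -/
structure IsRep (q : Param) {B : Type*} [Ring B] [Algebra ℂ B] (a b c d : B) : Prop where
  ab : a * b = qc q • (b * a)
  ac : a * c = qc q • (c * a)
  bd : b * d = qc q • (d * b)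
  cd : c * d = qc q • (d * c)
  bc : b * c = c * b
  ad : a * d = 1 + qc q • (c * b)
  da : d * a = 1 + (qc q)⁻¹ • (b * c)

open FreeAlgebra in
/-- The defining relations, in the free algebra on the generators. -/
inductive Rel (q : Param) : FreeAlgebra ℂ Gen → FreeAlgebra ℂ Gen → Prop
  | ab : Rel q (ι ℂ .a * ι ℂ .b) (qc q • (ι ℂ .b * ι ℂ .a))
  | ac : Rel q (ι ℂ .a * ι ℂ .c) (qc q • (ι ℂ .c * ι ℂ .a))
  | bd : Rel q (ι ℂ .b * ι ℂ .d) (qc q • (ι ℂ .d * ι ℂ .b))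
  | cd : Rel q (ι ℂ .c * ι ℂ .d) (qc q • (ι ℂ .d * ι ℂ .c))
  | bc : Rel q (ι ℂ .b * ι ℂ .c) (ι ℂ .c * ι ℂ .b)
  | ad : Rel q (ι ℂ .a * ι ℂ .d) (1 + qc q • (ι ℂ .c * ι ℂ .b))
  | da : Rel q (ι ℂ .d * ι ℂ .a) (1 + (qc q)⁻¹ • (ι ℂ .b * ι ℂ .c))

/-- The coordinate algebra `𝒪(SU_q(2))`: the unital complex algebra with generators
`a, b, c, d` and the relations above. -/
def CoordAlg (q : Param) : Type := RingQuot (Rel q)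

namespace CoordAlg

variable {q : Param}

instance : Ring (CoordAlg q) := inferInstanceAs (Ring (RingQuot (Rel q)))
instance : Algebra ℂ (CoordAlg q) := inferInstanceAs (Algebra ℂ (RingQuot (Rel q)))

/-- The quotient map from the free algebra. -/
def mk (q : Param) : FreeAlgebra ℂ Gen →ₐ[ℂ] CoordAlg q := RingQuot.mkAlgHom ℂ (Rel q)

/-- The class of a generator. -/
def gen (q : Param) (i : Gen) : CoordAlg q := mk q (FreeAlgebra.ι ℂ i)

/-- The generator `a`. -/
def a (q : Param) : CoordAlg q := gen q .a
/-- The generator `b`. -/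
def b (q : Param) : CoordAlg q := gen q .b
/-- The generator `c`. -/
def c (q : Param) : CoordAlg q := gen q .c
/-- The generator `d`. -/
def d (q : Param) : CoordAlg q := gen q .d

theorem isRep (q : Param) : IsRep q (a q) (b q) (c q) (d q) := by
  have key : ∀ x y, Rel q x y → mk q x = mk q y :=
    fun x y h => RingQuot.mkAlgHom_rel ℂ h
  constructor
  · have h := key _ _ Rel.ab
    simp only [map_mul, map_smul] at h
    exact h
  · have h := key _ _ Rel.ac
    simp only [map_mul, map_smul] at h
    exact h
  · have h := key _ _ Rel.bd
    simp only [map_mul, map_smul] at h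
    exact h
  · have h := key _ _ Rel.cd
    simp only [map_mul, map_smul] at h
    exact h
  · have h := key _ _ Rel.bc
    simp only [map_mul] at h
    exact h
  · have h := key _ _ Rel.ad
    simp only [map_mul, map_smul, map_add, map_one] at h
    exact h
  · have h := key _ _ Rel.da
    simp only [map_mul, map_smul, map_add, map_one] at h
    exact h

/-- Universal property: a solution of the relations in `B` gives an algebra map. -/
def lift {B : Type*} [Ring B] [Algebra ℂ B] {x y z w : B} (h : IsRep q x y z w) :
    CoordAlg q →ₐ[ℂ] B :=
  RingQuot.liftAlgHom ℂ
    ⟨FreeAlgebra.lift ℂ (fun i : Gen => match i with | .a => x | .b => y | .c => z | .d => w), by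
      intro u v huv
      cases huv
      · simpa only [map_mul, map_smul, FreeAlgebra.lift_ι_apply] using h.ab
      · simpa only [map_mul, map_smul, FreeAlgebra.lift_ι_apply] using h.ac
      · simpa only [map_mul, map_smul, FreeAlgebra.lift_ι_apply] using h.bd
      · simpa only [map_mul, map_smul, FreeAlgebra.lift_ι_apply] using h.cd
      · simpa only [map_mul, map_smul, FreeAlgebra.lift_ι_apply] using h.bc
      · simpa only [map_mul, map_smul, map_add, map_one, FreeAlgebra.lift_ι_apply] using h.ad
      · simpa only [map_mul, map_smul, map_add, map_one, FreeAlgebra.lift_ι_apply] using h.da⟩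

section lift

variable {B : Type*} [Ring B] [Algebra ℂ B] {x y z w : B} (h : IsRep q x y z w)

@[simp] theorem lift_a : lift h (a q) = x := by
  simp only [lift, a, gen, mk]
  erw [RingQuot.liftAlgHom_mkAlgHom_apply]
  simp
@[simp] theorem lift_b : lift h (b q) = y := by
  simp only [lift, b, gen, mk]
  erw [RingQuot.liftAlgHom_mkAlgHom_apply]
  simp
@[simp] theorem lift_c : lift h (c q) = z := by
  simp only [lift, c, gen, mk]
  erw [RingQuot.liftAlgHom_mkAlgHom_apply]
  simp
@[simp] theorem lift_d : lift h (d q) = w := by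
  simp only [lift, d, gen, mk]
  erw [RingQuot.liftAlgHom_mkAlgHom_apply]
  simp

end lift

/-- Induction on elements of the coordinate algebra. -/
theorem induction {P : CoordAlg q → Prop} (scalar : ∀ r : ℂ, P (algebraMap ℂ _ r))
    (ha : P (a q)) (hb : P (b q)) (hc : P (c q)) (hd : P (d q))
    (add : ∀ x y, P x → P y → P (x + y)) (mul : ∀ x y, P x → P y → P (x * y))
    (x : CoordAlg q) : P x := by
  obtain ⟨t, rfl⟩ := RingQuot.mkAlgHom_surjective ℂ (Rel q) x
  induction t using FreeAlgebra.induction with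
  | grade0 r => rw [AlgHom.commutes]; exact scalar r
  | grade1 i => cases i <;> assumption
  | mul u v hu hv => rw [map_mul]; exact mul _ _ hu hv
  | add u v hu hv => rw [map_add]; exact add _ _ hu hv

theorem algHom_ext {B : Type*} [Semiring B] [Algebra ℂ B] {f g : CoordAlg q →ₐ[ℂ] B}
    (ha : f (a q) = g (a q)) (hb : f (b q) = g (b q))
    (hc : f (c q) = g (c q)) (hd : f (d q) = g (d q)) : f = g := by
  ext x
  induction x using CoordAlg.induction with
  | scalar r => simp
  | ha => exact ha
  | hb => exact hb
  | hc => exact hc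
  | hd => exact hd
  | add x y hx hy => simp [hx, hy]
  | mul x y hx hy => simp [hx, hy]

/-! ### The Hopf algebra structure -/

theorem comul_isRep (q : Param) : IsRep q (B := CoordAlg q ⊗[ℂ] CoordAlg q)
    (a q ⊗ₜ a q + b q ⊗ₜ c q) (a q ⊗ₜ b q + b q ⊗ₜ d q)
    (c q ⊗ₜ a q + d q ⊗ₜ c q) (c q ⊗ₜ b q + d q ⊗ₜ d q) := by
  have R := isRep q
  have hq := qc_ne_zero q
  constructor
  all_goals simp only [mul_add, add_mul, Algebra.TensorProduct.tmul_mul_tmul, R.ab, R.ac, R.bd,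
    R.cd, R.bc, R.ad, R.da, TensorProduct.tmul_add, TensorProduct.add_tmul,
    ← TensorProduct.smul_tmul', TensorProduct.tmul_smul, smul_add, smul_smul,
    Algebra.TensorProduct.one_def, mul_inv_cancel₀ hq, inv_mul_cancel₀ hq, one_smul]
  all_goals abel


/-- The coproduct, `Δ(u_{ij}) = ∑ₖ u_{ik} ⊗ u_{kj}` for the matrix `u = ((a, b), (c, d))`. -/
def comulHom (q : Param) : CoordAlg q →ₐ[ℂ] CoordAlg q ⊗[ℂ] CoordAlg q := lift (comul_isRep q)

theorem counit_isRep (q : Param) : IsRep q (1 : ℂ) 0 0 1 := by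
  constructor <;> simp

/-- The counit, `ε(u_{ij}) = δ_{ij}`. -/
def counitHom (q : Param) : CoordAlg q →ₐ[ℂ] ℂ := lift (counit_isRep q)

instance : Bialgebra ℂ (CoordAlg q) :=
  Bialgebra.ofAlgHom (comulHom q) (counitHom q)
    (by
      apply algHom_ext <;>
      simp [comulHom, TensorProduct.add_tmul, TensorProduct.tmul_add] <;> abel)
    (by
      apply algHom_ext <;>
      simp [comulHom, counitHom])
    (by
      apply algHom_ext <;>
      simp [comulHom, counitHom])

theorem comul_eq (x : CoordAlg q) : Coalgebra.comul (R := ℂ) x = comulHom q x := rfl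
theorem counit_eq (x : CoordAlg q) : Coalgebra.counit (R := ℂ) x = counitHom q x := rfl

open MulOpposite in
theorem antipode_isRep (q : Param) : IsRep q (op (d q)) (op (-((qc q)⁻¹ • b q)))
    (op (-(qc q • c q))) (op (a q)) := by
  have R := isRep q
  have hq := qc_ne_zero q
  constructor
  all_goals simp only [← op_mul, ← op_smul, ← op_add, ← op_one, neg_mul, mul_neg, neg_neg,
    smul_mul_assoc, mul_smul_comm, smul_neg, R.ab, R.ac, R.bd, R.cd, R.bc, R.ad, R.da,
    smul_smul, mul_inv_cancel₀ hq, inv_mul_cancel₀ hq, one_smul]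

/-- The antipode as an algebra map into the opposite algebra. -/
def antipodeHom (q : Param) : CoordAlg q →ₐ[ℂ] (CoordAlg q)ᵐᵒᵖ := lift (antipode_isRep q)

/-- The antipode: `S(a) = d`, `S(b) = -q⁻¹ b`, `S(c) = -q c`, `S(d) = a`. -/
def antipodeMap (q : Param) : CoordAlg q →ₗ[ℂ] CoordAlg q :=
  (MulOpposite.opLinearEquiv ℂ).symm.toLinearMap ∘ₗ (antipodeHom q).toLinearMap

theorem antipodeMap_mul (x y : CoordAlg q) :
    antipodeMap q (x * y) = antipodeMap q y * antipodeMap q x := by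
  simp [antipodeMap]

theorem antipode_left_mul (u : CoordAlg q ⊗[ℂ] CoordAlg q) (s t : CoordAlg q) :
    LinearMap.mul' ℂ _ ((antipodeMap q).rTensor _ (u * (s ⊗ₜ t))) =
      antipodeMap q s * LinearMap.mul' ℂ _ ((antipodeMap q).rTensor _ u) * t := by
  induction u using TensorProduct.induction_on with
  | zero => simp
  | tmul x y => simp [antipodeMap_mul, mul_assoc]
  | add x y hx hy => simp only [add_mul, map_add, hx, hy, mul_add]

theorem antipode_left (x : CoordAlg q) :
    LinearMap.mul' ℂ _ ((antipodeMap q).rTensor _ (comulHom q x)) =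
      algebraMap ℂ _ (counitHom q x) := by
  have R := isRep q
  have hq := qc_ne_zero q
  induction x using CoordAlg.induction with
  | scalar r => simp [antipodeMap, Algebra.TensorProduct.algebraMap_apply]
  | ha => simp [antipodeMap, antipodeHom, comulHom, counitHom, R.da]
  | hb => simp [antipodeMap, antipodeHom, comulHom, counitHom, R.bd, hq]
  | hc => simp [antipodeMap, antipodeHom, comulHom, counitHom, R.ac]
  | hd => simp [antipodeMap, antipodeHom, comulHom, counitHom, R.ad]
  | add x y hx hy => simp only [map_add, hx, hy]
  | mul x y hx hy =>
    rw [map_mul (comulHom q), map_mul (counitHom q), map_mul (algebraMap ℂ (CoordAlg q))]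
    have key : ∀ v : CoordAlg q ⊗[ℂ] CoordAlg q,
        LinearMap.mul' ℂ _ ((antipodeMap q).rTensor _ (comulHom q x * v)) =
          counitHom q x • LinearMap.mul' ℂ _ ((antipodeMap q).rTensor _ v) := by
      intro v
      induction v using TensorProduct.induction_on with
      | zero => simp
      | tmul s t =>
        rw [antipode_left_mul, hx, ← Algebra.commutes, mul_assoc, ← Algebra.smul_def]
        simp
      | add x y hx hy => simp only [mul_add, map_add, hx, hy, smul_add]
    rw [key, hy, Algebra.smul_def]

theorem antipode_right_mul (u : CoordAlg q ⊗[ℂ] CoordAlg q) (s t : CoordAlg q) :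
    LinearMap.mul' ℂ _ ((antipodeMap q).lTensor _ ((s ⊗ₜ t) * u)) =
      s * LinearMap.mul' ℂ _ ((antipodeMap q).lTensor _ u) * antipodeMap q t := by
  induction u using TensorProduct.induction_on with
  | zero => simp
  | tmul x y => simp [antipodeMap_mul, mul_assoc]
  | add x y hx hy => simp only [add_mul, map_add, hx, hy, mul_add]

theorem antipode_right (x : CoordAlg q) :
    LinearMap.mul' ℂ _ ((antipodeMap q).lTensor _ (comulHom q x)) =
      algebraMap ℂ _ (counitHom q x) := by
  have R := isRep q
  have hq := qc_ne_zero q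
  induction x using CoordAlg.induction with
  | scalar r => simp [antipodeMap, Algebra.TensorProduct.algebraMap_apply]
  | ha => simp [antipodeMap, antipodeHom, comulHom, counitHom, R.ad, R.bc]
  | hb => simp [antipodeMap, antipodeHom, comulHom, counitHom, R.ab, hq]
  | hc => simp [antipodeMap, antipodeHom, comulHom, counitHom, R.cd]
  | hd => simp [antipodeMap, antipodeHom, comulHom, counitHom, R.da, R.bc]
  | add x y hx hy => simp only [map_add, hx, hy]
  | mul x y hx hy =>
    rw [map_mul (comulHom q), map_mul (counitHom q), map_mul (algebraMap ℂ (CoordAlg q))]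
    have key : ∀ v : CoordAlg q ⊗[ℂ] CoordAlg q,
        LinearMap.mul' ℂ _ ((antipodeMap q).lTensor _ (v * comulHom q y)) =
          counitHom q y • LinearMap.mul' ℂ _ ((antipodeMap q).lTensor _ v) := by
      intro v
      induction v using TensorProduct.induction_on with
      | zero => simp
      | tmul s t =>
        rw [antipode_right_mul, hy, ← Algebra.commutes, mul_assoc, ← Algebra.smul_def]
        simp
      | add x y hx hy => simp only [add_mul, map_add, hx, hy, smul_add]
    rw [key, hx, ← Algebra.commutes, Algebra.smul_def, Algebra.commutes]

instance : HopfAlgebra ℂ (CoordAlg q) where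
  antipode := antipodeMap q
  mul_antipode_rTensor_comul := LinearMap.ext antipode_left
  mul_antipode_lTensor_comul := LinearMap.ext antipode_right

end CoordAlg

namespace CoordAlg
variable {q : Param}

/-! ### The involution -/

/-- The opposite algebra with conjugated scalars; conjugate-linear antihomomorphisms of the
coordinate algebra are algebra maps into it. -/
def ConjOp (q : Param) : Type := (CoordAlg q)ᵐᵒᵖ

instance : Ring (ConjOp q) := inferInstanceAs (Ring (CoordAlg q)ᵐᵒᵖ)
instance : Algebra ℂ (ConjOp q) :=
  ((algebraMap ℂ (CoordAlg q)ᵐᵒᵖ).comp (starRingEnd ℂ)).toAlgebra' (fun r x =>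
    Algebra.commutes (A := (CoordAlg q)ᵐᵒᵖ) ((starRingEnd ℂ) r) x)

/-- The identity map into `ConjOp q`. -/
def toConj (x : CoordAlg q) : ConjOp q := MulOpposite.op x
/-- The identity map out of `ConjOp q`. -/
def ofConj (x : ConjOp q) : CoordAlg q := MulOpposite.unop x

theorem toConj_mul (x y : CoordAlg q) : toConj x * toConj y = toConj (y * x) := rfl
theorem toConj_add (x y : CoordAlg q) : toConj x + toConj y = toConj (x + y) := rfl
theorem toConj_one : (1 : ConjOp q) = toConj 1 := rfl
theorem toConj_smul (r : ℂ) (x : CoordAlg q) :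
    r • toConj x = toConj ((starRingEnd ℂ) r • x) := by
  rw [Algebra.smul_def, Algebra.smul_def, Algebra.commutes]
  rfl
theorem conj_qc (q : Param) : (starRingEnd ℂ) (qc q) = qc q := Complex.conj_ofReal _

theorem star_isRep (q : Param) : IsRep q (toConj (d q)) (toConj (-(qc q • c q)))
    (toConj (-((qc q)⁻¹ • b q))) (toConj (a q)) := by
  have R := isRep q
  have hq := qc_ne_zero q
  constructor
  all_goals simp only [toConj_mul, toConj_add, toConj_one, toConj_smul, conj_qc, map_inv₀, neg_mul,
    mul_neg, neg_neg, smul_mul_assoc, mul_smul_comm, smul_neg, R.ab, R.ac, R.bd, R.cd, R.bc, R.ad,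
    R.da, smul_smul, mul_inv_cancel₀ hq, inv_mul_cancel₀ hq, one_smul]

/-- The involution as an algebra map into `ConjOp q`. -/
def starHom (q : Param) : CoordAlg q →ₐ[ℂ] ConjOp q := lift (star_isRep q)

/-- The involution: the conjugate-linear antihomomorphism with `a* = d`, `b* = -q c`,
`c* = -q⁻¹ b`, `d* = a`. -/
def starMap (x : CoordAlg q) : CoordAlg q := ofConj (starHom q x)

theorem starMap_mul (x y : CoordAlg q) : starMap (x * y) = starMap y * starMap x := by
  unfold starMap; rw [map_mul]; rfl
theorem starMap_add (x y : CoordAlg q) : starMap (x + y) = starMap x + starMap y := by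
  unfold starMap; rw [map_add]; rfl
theorem starMap_smul (r : ℂ) (x : CoordAlg q) :
    starMap (r • x) = (starRingEnd ℂ) r • starMap x := by
  unfold starMap; rw [map_smul]; exact congrArg ofConj (toConj_smul r (ofConj (starHom q x)))
theorem starMap_one : starMap (1 : CoordAlg q) = 1 := by
  unfold starMap; rw [map_one]; rfl
theorem starMap_a : starMap (a q) = d q := by
  unfold starMap starHom; rw [lift_a]; rfl
theorem starMap_b : starMap (b q) = -(qc q • c q) := by
  unfold starMap starHom; rw [lift_b]; rfl
theorem starMap_c : starMap (c q) = -((qc q)⁻¹ • b q) := by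
  unfold starMap starHom; rw [lift_c]; rfl
theorem starMap_d : starMap (d q) = a q := by
  unfold starMap starHom; rw [lift_d]; rfl
theorem starMap_neg (x : CoordAlg q) : starMap (-x) = -starMap x := by
  rw [← neg_one_smul ℂ x, starMap_smul]; simp

theorem starMap_starMap (x : CoordAlg q) : starMap (starMap x) = x := by
  have hq := qc_ne_zero q
  induction x using CoordAlg.induction with
  | scalar r => rw [Algebra.algebraMap_eq_smul_one, starMap_smul, starMap_one, starMap_smul,
      starMap_one, Complex.conj_conj]
  | ha => rw [starMap_a, starMap_d]
  | hb => rw [starMap_b, starMap_neg, starMap_smul, starMap_c, conj_qc]; simp [smul_smul, hq]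
  | hc => rw [starMap_c, starMap_neg, starMap_smul, starMap_b, map_inv₀, conj_qc]
          simp [smul_smul, hq]
  | hd => rw [starMap_d, starMap_a]
  | add x y hx hy => rw [starMap_add, starMap_add, hx, hy]
  | mul x y hx hy => rw [starMap_mul, starMap_mul, hx, hy]

instance : StarRing (CoordAlg q) where
  star := starMap
  star_involutive := starMap_starMap
  star_mul := starMap_mul
  star_add := starMap_add

instance : StarModule ℂ (CoordAlg q) where
  star_smul := starMap_smul

theorem star_a : star (a q) = d q := starMap_a
theorem star_b : star (b q) = -(qc q • c q) := starMap_b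
theorem star_c : star (c q) = -((qc q)⁻¹ • b q) := starMap_c
theorem star_d : star (d q) = a q := starMap_d

end CoordAlg

/-! ### The Haar state

It is computed from the representation on the span of the vectors `e_{n,m}`
(`n ∈ ℕ`, `m ∈ ℤ`) given by `a e_{n,m} = √(1-q^{2n}) e_{n-1,m}`,
`b e_{n,m} = -q^{n+1} e_{n,m-1}`, `c e_{n,m} = q^n e_{n,m+1}`,
`d e_{n,m} = √(1-q^{2n+2}) e_{n+1,m}`, as
`h(x) = (1-q²) ∑ₙ q^{2n} ⟨e_{n,0}, x e_{n,0}⟩`. -/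

/-- The span of the vectors `e_{n,m}`. -/
abbrev Vec : Type := (ℕ × ℤ) →₀ ℂ

/-- The basis vector `e_{n,m}`. -/
def bvec (n : ℕ) (m : ℤ) : Vec := Finsupp.single (n, m) 1

/-- The operator sending `e_{n,m}` to `w n • e_{f(n,m)}`. -/
def shiftOp (f : ℕ × ℤ → ℕ × ℤ) (w : ℕ → ℂ) : Module.End ℂ Vec :=
  Finsupp.linearCombination ℂ fun p => w p.1 • (Finsupp.single (f p) 1 : Vec)

theorem shiftOp_bvec (f : ℕ × ℤ → ℕ × ℤ) (w : ℕ → ℂ) (n : ℕ) (m : ℤ) :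
    shiftOp f w (bvec n m) = w n • bvec (f (n, m)).1 (f (n, m)).2 := by
  simp [shiftOp, bvec]

theorem vec_ext {f g : Module.End ℂ Vec} (h : ∀ n m, f (bvec n m) = g (bvec n m)) : f = g := by
  apply Finsupp.lhom_ext
  rintro ⟨n, m⟩ r
  have := congrArg (fun v => r • v) (h n m)
  simpa only [bvec, ← map_smul, Finsupp.smul_single, smul_eq_mul, mul_one] using this

/-- The number `√(1 - q^n)` as a complex scalar. -/
def rt (q : Param) (n : ℕ) : ℂ := ((Real.sqrt (1 - (q : ℝ) ^ n) : ℝ) : ℂ)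

theorem one_sub_pow_nonneg (q : Param) (n : ℕ) : 0 ≤ 1 - (q : ℝ) ^ n :=
  sub_nonneg.2 (pow_le_one₀ q.2.1.le q.2.2.le)

theorem rt_mul_rt (q : Param) (n : ℕ) : rt q n * rt q n = 1 - qc q ^ n := by
  rw [rt, ← Complex.ofReal_mul, Real.mul_self_sqrt (one_sub_pow_nonneg q n)]
  simp [qc]

theorem rt_zero (q : Param) : rt q 0 = 0 := by simp [rt]

/-- The image of `a`. -/
def opA (q : Param) : Module.End ℂ Vec :=
  shiftOp (fun p => (p.1 - 1, p.2)) fun n => rt q (2 * n)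
/-- The image of `b`. -/
def opB (q : Param) : Module.End ℂ Vec :=
  shiftOp (fun p => (p.1, p.2 - 1)) fun n => -qc q ^ (n + 1)
/-- The image of `c`. -/
def opC (q : Param) : Module.End ℂ Vec :=
  shiftOp (fun p => (p.1, p.2 + 1)) fun n => qc q ^ n
/-- The image of `d`. -/
def opD (q : Param) : Module.End ℂ Vec :=
  shiftOp (fun p => (p.1 + 1, p.2)) fun n => rt q (2 * (n + 1))

theorem opA_zero (q : Param) (m : ℤ) : opA q (bvec 0 m) = 0 := by
  simp [opA, shiftOp_bvec, rt_zero]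
theorem opA_succ (q : Param) (n : ℕ) (m : ℤ) :
    opA q (bvec (n + 1) m) = rt q (2 * (n + 1)) • bvec n m := by
  simp [opA, shiftOp_bvec]
theorem opB_bvec (q : Param) (n : ℕ) (m : ℤ) :
    opB q (bvec n m) = (-qc q ^ (n + 1)) • bvec n (m - 1) := shiftOp_bvec _ _ _ _
theorem opC_bvec (q : Param) (n : ℕ) (m : ℤ) :
    opC q (bvec n m) = qc q ^ n • bvec n (m + 1) := shiftOp_bvec _ _ _ _
theorem opD_bvec (q : Param) (n : ℕ) (m : ℤ) :
    opD q (bvec n m) = rt q (2 * (n + 1)) • bvec (n + 1) m := shiftOp_bvec _ _ _ _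

theorem op_isRep (q : Param) : IsRep q (opA q) (opB q) (opC q) (opD q) := by
  have hq := qc_ne_zero q
  constructor
  all_goals
    apply vec_ext
    intro n m
    rcases n with _ | n
    all_goals
      simp only [Module.End.mul_apply, LinearMap.smul_apply, LinearMap.add_apply,
        Module.End.one_apply, opA_zero, opA_succ, opB_bvec, opC_bvec, opD_bvec, map_smul, smul_smul,
        smul_zero, map_zero, rt_mul_rt, add_sub_cancel_right, sub_add_cancel]
      try match_scalars
      try (field_simp <;> ring)

/-- The representation on `Vec`. -/
def rep (q : Param) : CoordAlg q →ₐ[ℂ] Module.End ℂ Vec := CoordAlg.lift (op_isRep q)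

/-- The inner product on `Vec` for which the `e_{n,m}` are orthonormal, conjugate-linear in the
first variable. -/
def vinner (u v : Vec) : ℂ := u.sum fun p z => (starRingEnd ℂ) z * v p

theorem vinner_bvec_left (n : ℕ) (m : ℤ) (v : Vec) : vinner (bvec n m) v = v (n, m) := by
  simp [vinner, bvec]

open CoordAlg

theorem vinner_add_left (u u' v : Vec) : vinner (u + u') v = vinner u v + vinner u' v := by
  simp [vinner, Finsupp.sum_add_index', add_mul]

theorem vinner_smul_left (r : ℂ) (u v : Vec) :
    vinner (r • u) v = (starRingEnd ℂ) r * vinner u v := by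
  simp [vinner, Finsupp.sum_smul_index', Finsupp.mul_sum, mul_assoc]

theorem vinner_conj (u v : Vec) : (starRingEnd ℂ) (vinner u v) = vinner v u := by
  have h1 : vinner u v = ∑ p ∈ u.support ∪ v.support, (starRingEnd ℂ) (u p) * v p :=
    Finsupp.sum_of_support_subset _ Finset.subset_union_left _ (by simp)
  have h2 : vinner v u = ∑ p ∈ u.support ∪ v.support, (starRingEnd ℂ) (v p) * u p :=
    Finsupp.sum_of_support_subset _ Finset.subset_union_right _ (by simp)
  rw [h1, h2, map_sum]
  exact Finset.sum_congr rfl fun p _ => by rw [map_mul, Complex.conj_conj, mul_comm]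

theorem vinner_add_right (u v v' : Vec) : vinner u (v + v') = vinner u v + vinner u v' := by
  rw [← vinner_conj, vinner_add_left, map_add, vinner_conj, vinner_conj]

theorem vinner_smul_right (r : ℂ) (u v : Vec) : vinner u (r • v) = r * vinner u v := by
  rw [← vinner_conj, vinner_smul_left, map_mul, Complex.conj_conj, vinner_conj]

theorem vinner_neg_left (u v : Vec) : vinner (-u) v = -vinner u v := by
  rw [← neg_one_smul ℂ u, vinner_smul_left]; simp

theorem vinner_neg_right (u v : Vec) : vinner u (-v) = -vinner u v := by
  rw [← neg_one_smul ℂ v, vinner_smul_right]; simp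

theorem vinner_zero_left (v : Vec) : vinner 0 v = 0 := by simp [vinner]

theorem vinner_zero_right (v : Vec) : vinner v 0 = 0 := by simp [vinner]

theorem vinner_self_nonneg (u : Vec) : 0 ≤ (vinner u u).re := by
  rw [vinner, Finsupp.sum, Complex.re_sum]
  refine Finset.sum_nonneg fun p _ => ?_
  rw [← Complex.normSq_eq_conj_mul_self]
  simpa using Complex.normSq_nonneg _

theorem vinner_ext {S T : Module.End ℂ Vec}
    (h : ∀ n m n' m', vinner (S (bvec n m)) (bvec n' m') = vinner (bvec n m) (T (bvec n' m')))
    (u v : Vec) : vinner (S u) v = vinner u (T v) := by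
  induction u using Finsupp.induction_linear with
  | zero => simp [vinner_zero_left]
  | add u u' hu hu' => rw [map_add, vinner_add_left, vinner_add_left, hu, hu']
  | single p r =>
    have hp : (Finsupp.single p r : Vec) = r • bvec p.1 p.2 := by simp [bvec]
    rw [hp, map_smul, vinner_smul_left, vinner_smul_left]
    congr 1
    induction v using Finsupp.induction_linear with
    | zero => simp [vinner_zero_right]
    | add v v' hv hv' => rw [map_add, vinner_add_right, vinner_add_right, hv, hv']
    | single p' r' =>
      have hp' : (Finsupp.single p' r' : Vec) = r' • bvec p'.1 p'.2 := by simp [bvec]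
      rw [hp', map_smul, vinner_smul_right, vinner_smul_right, h]

theorem vinner_bvec (n n' : ℕ) (m m' : ℤ) :
    vinner (bvec n m) (bvec n' m') = if n = n' ∧ m = m' then 1 else 0 := by
  rw [vinner_bvec_left, bvec, Finsupp.single_apply]
  simp only [Prod.mk.injEq, eq_comm]

theorem conj_rt (q : Param) (n : ℕ) : (starRingEnd ℂ) (rt q n) = rt q n := Complex.conj_ofReal _

theorem adj_da (q : Param) (u v : Vec) : vinner (opD q u) v = vinner u (opA q v) := by
  apply vinner_ext
  rintro n m (_ | n') m'
  · simp [opD_bvec, opA_zero, vinner_smul_left, vinner_bvec, vinner_zero_right]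
  · simp only [opD_bvec, opA_succ, vinner_smul_left, vinner_smul_right, vinner_bvec, conj_rt]
    by_cases h : n = n'
    · subst h; simp
    · simp [h]

theorem adj_ad (q : Param) (u v : Vec) : vinner (opA q u) v = vinner u (opD q v) := by
  rw [← vinner_conj, ← adj_da, vinner_conj]

theorem adj_cb (q : Param) (u v : Vec) :
    vinner (-(qc q • opC q u)) v = vinner u (opB q v) := by
  have := vinner_ext (S := -(qc q • opC q)) (T := opB q) ?_ u v
  · simpa using this
  · intro n m n' m'
    simp only [LinearMap.neg_apply, LinearMap.smul_apply, opC_bvec, opB_bvec, vinner_neg_left,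
      vinner_smul_left, vinner_smul_right, vinner_bvec, map_pow, conj_qc]
    by_cases h : n = n' ∧ m + 1 = m'
    · obtain ⟨rfl, rfl⟩ := h; simp; ring
    · have h' : ¬ (n = n' ∧ m = m' - 1) := fun h' => h ⟨h'.1, by omega⟩
      simp [h, h']

theorem adj_bc (q : Param) (u v : Vec) :
    vinner (-((qc q)⁻¹ • opB q u)) v = vinner u (opC q v) := by
  have hq := qc_ne_zero q
  have h := adj_cb q v u
  rw [vinner_neg_left, vinner_smul_left, conj_qc] at h
  rw [vinner_neg_left, vinner_smul_left, map_inv₀, conj_qc, ← vinner_conj, ← h, map_neg, map_mul,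
    conj_qc, vinner_conj]
  field_simp

theorem rep_star (q : Param) (x : CoordAlg q) :
    ∀ u v, vinner (rep q (star x) u) v = vinner u (rep q x v) := by
  have e : ∀ y : CoordAlg q, star y = starMap y := fun _ => rfl
  induction x using CoordAlg.induction with
  | scalar r =>
    intro u v
    rw [Algebra.algebraMap_eq_smul_one, star_smul, star_one, map_smul, map_smul, map_one]
    simp [vinner_smul_left, vinner_smul_right]
  | ha => intro u v; rw [star_a]; simpa [rep] using adj_da q u v
  | hb => intro u v; rw [star_b]; simpa [rep] using adj_cb q u v
  | hc => intro u v; rw [star_c]; simpa [rep] using adj_bc q u v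
  | hd => intro u v; rw [star_d]; simpa [rep] using adj_ad q u v
  | add x y hx hy =>
    intro u v
    rw [star_add, map_add, map_add, LinearMap.add_apply, LinearMap.add_apply, vinner_add_left,
      vinner_add_right, hx, hy]
  | mul x y hx hy =>
    intro u v
    rw [star_mul, map_mul, map_mul, Module.End.mul_apply, Module.End.mul_apply, hy, hx]

/-- The `ℓ¹` norm on `Vec`. -/
def vnorm (v : Vec) : ℝ := v.sum fun _ z => ‖z‖

theorem vnorm_nonneg (v : Vec) : 0 ≤ vnorm v := Finset.sum_nonneg fun _ _ => norm_nonneg _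

theorem vnorm_single (p : ℕ × ℤ) (r : ℂ) : vnorm (Finsupp.single p r) = ‖r‖ := by
  simp [vnorm]

theorem vnorm_add (u v : Vec) : vnorm (u + v) ≤ vnorm u + vnorm v := by
  have h1 : ∀ w : Vec, w.support ⊆ u.support ∪ v.support →
      vnorm w = ∑ p ∈ u.support ∪ v.support, ‖w p‖ := fun w hw =>
    Finsupp.sum_of_support_subset _ hw _ (by simp)
  rw [h1 _ Finsupp.support_add, h1 u Finset.subset_union_left, h1 v Finset.subset_union_right,
    ← Finset.sum_add_distrib]
  exact Finset.sum_le_sum fun p _ => norm_add_le _ _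

theorem vnorm_smul (r : ℂ) (v : Vec) : vnorm (r • v) = ‖r‖ * vnorm v := by
  simp [vnorm, Finsupp.sum_smul_index', Finsupp.mul_sum]

theorem norm_apply_le_vnorm (v : Vec) (p : ℕ × ℤ) : ‖v p‖ ≤ vnorm v := by
  by_cases hp : p ∈ v.support
  · exact Finset.single_le_sum (f := fun p => ‖v p‖) (fun _ _ => norm_nonneg _) hp
  · rw [Finsupp.notMem_support_iff.1 hp, norm_zero]; exact vnorm_nonneg v

theorem vnorm_shiftOp_le (f : ℕ × ℤ → ℕ × ℤ) (w : ℕ → ℂ) (hw : ∀ n, ‖w n‖ ≤ 1) (v : Vec) :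
    vnorm (shiftOp f w v) ≤ vnorm v := by
  induction v using Finsupp.induction with
  | zero => simp
  | single_add p r v hp hr ih =>
    have h1 : vnorm (Finsupp.single p r + v) = ‖r‖ + vnorm v := by
      rw [vnorm, Finsupp.sum_add_index_of_disjoint]
      · rw [Finsupp.sum_single_index (by simp)]; rfl
      · rw [Finsupp.support_single p hr]; simpa using hp
    rw [h1, map_add]
    refine (vnorm_add _ _).trans (add_le_add ?_ ih)
    rw [shiftOp, Finsupp.linearCombination_single, vnorm_smul, vnorm_smul, vnorm_single, norm_one,
      mul_one]
    exact mul_le_of_le_one_right (norm_nonneg _) (hw _)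

theorem norm_qc_pow_le (q : Param) (n : ℕ) : ‖qc q ^ n‖ ≤ 1 := by
  have h0 : (0 : ℝ) < q := q.2.1
  have h1 : ‖qc q‖ = (q : ℝ) := by rw [qc, Complex.norm_real, Real.norm_of_nonneg h0.le]
  rw [norm_pow, h1]
  exact pow_le_one₀ h0.le q.2.2.le

theorem norm_rt_le (q : Param) (n : ℕ) : ‖rt q n‖ ≤ 1 := by
  have : (0 : ℝ) ≤ (q : ℝ) ^ n := pow_nonneg q.2.1.le n
  rw [rt, Complex.norm_real, Real.norm_of_nonneg (Real.sqrt_nonneg _)]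
  exact Real.sqrt_le_one.2 (by linarith)

theorem rep_bounded (q : Param) (x : CoordAlg q) :
    ∃ C : ℝ, 0 ≤ C ∧ ∀ v, vnorm (rep q x v) ≤ C * vnorm v := by
  induction x using CoordAlg.induction with
  | scalar r =>
    refine ⟨‖r‖, norm_nonneg _, fun v => ?_⟩
    rw [Algebra.algebraMap_eq_smul_one, map_smul, map_one]
    simp [vnorm_smul]
  | ha => exact ⟨1, zero_le_one, fun v => by
      simpa [rep, opA] using vnorm_shiftOp_le _ _ (fun n => norm_rt_le q _) v⟩
  | hb => exact ⟨1, zero_le_one, fun v => by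
      simpa [rep, opB] using vnorm_shiftOp_le _ _ (fun n => by
        rw [norm_neg]; exact norm_qc_pow_le q _) v⟩
  | hc => exact ⟨1, zero_le_one, fun v => by
      simpa [rep, opC] using vnorm_shiftOp_le _ _ (fun n => norm_qc_pow_le q _) v⟩
  | hd => exact ⟨1, zero_le_one, fun v => by
      simpa [rep, opD] using vnorm_shiftOp_le _ _ (fun n => norm_rt_le q _) v⟩
  | add x y hx hy =>
    obtain ⟨C, hC, hx⟩ := hx
    obtain ⟨D, hD, hy⟩ := hy
    refine ⟨C + D, add_nonneg hC hD, fun v => ?_⟩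
    rw [map_add, LinearMap.add_apply, add_mul]
    exact (vnorm_add _ _).trans (add_le_add (hx v) (hy v))
  | mul x y hx hy =>
    obtain ⟨C, hC, hx⟩ := hx
    obtain ⟨D, hD, hy⟩ := hy
    refine ⟨C * D, mul_nonneg hC hD, fun v => ?_⟩
    rw [map_mul, Module.End.mul_apply, mul_assoc]
    exact (hx _).trans (mul_le_mul_of_nonneg_left (hy v) hC)

theorem haar_summable (q : Param) (x : CoordAlg q) :
    Summable fun n : ℕ => qc q ^ (2 * n) * rep q x (bvec n 0) (n, 0) := by
  obtain ⟨C, hC, h⟩ := rep_bounded q x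
  have h0 : (0 : ℝ) < q := q.2.1
  have h1 : ‖qc q‖ = (q : ℝ) := by rw [qc, Complex.norm_real, Real.norm_of_nonneg h0.le]
  refine Summable.of_norm_bounded
    ((summable_geometric_of_lt_one (sq_nonneg (q : ℝ)) (by nlinarith [q.2.2])).mul_right C)
    fun n => ?_
  rw [norm_mul, norm_pow, h1, pow_mul]
  refine mul_le_mul_of_nonneg_left ?_ (by positivity)
  refine (norm_apply_le_vnorm _ _).trans ((h _).trans ?_)
  rw [bvec, vnorm_single]; simp

/-- The Haar state `h(x) = (1-q²) ∑ₙ q^{2n} ⟨e_{n,0}, x e_{n,0}⟩`. -/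
def haar (q : Param) : CoordAlg q →ₗ[ℂ] ℂ where
  toFun x := (1 - qc q ^ 2) * ∑' n : ℕ, qc q ^ (2 * n) * rep q x (bvec n 0) (n, 0)
  map_add' x y := by
    rw [← mul_add, ← (haar_summable q x).tsum_add (haar_summable q y)]
    simp [mul_add]
  map_smul' r x := by
    have h : ∀ n : ℕ, qc q ^ (2 * n) * rep q (r • x) (bvec n 0) (n, 0) =
        r * (qc q ^ (2 * n) * rep q x (bvec n 0) (n, 0)) := fun n => by
      simp [mul_left_comm]
    rw [RingHom.id_apply, smul_eq_mul, tsum_congr h, tsum_mul_left, mul_left_comm]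

theorem haar_star_mul (q : Param) (x y : CoordAlg q) :
    haar q (star x * y) = (1 - qc q ^ 2) *
      ∑' n : ℕ, qc q ^ (2 * n) * vinner (rep q x (bvec n 0)) (rep q y (bvec n 0)) := by
  change (1 - qc q ^ 2) * _ = _
  refine congrArg _ (tsum_congr fun n => ?_)
  rw [map_mul, Module.End.mul_apply, ← vinner_bvec_left]
  conv_lhs => rw [← vinner_conj, rep_star, vinner_conj]

theorem haar_star_mul_conj (q : Param) (x y : CoordAlg q) :
    (starRingEnd ℂ) (haar q (star y * x)) = haar q (star x * y) := by
  rw [haar_star_mul, haar_star_mul, map_mul, Complex.conj_tsum]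
  simp [conj_qc, vinner_conj]

theorem haar_star_mul_self (q : Param) (x : CoordAlg q) :
    0 ≤ (haar q (star x * x)).re := by
  have hterm : ∀ n : ℕ, qc q ^ (2 * n) * vinner (rep q x (bvec n 0)) (rep q x (bvec n 0)) =
      (((q : ℝ) ^ (2 * n) * (vinner (rep q x (bvec n 0)) (rep q x (bvec n 0))).re : ℝ) : ℂ) := by
    intro n
    rw [Complex.ofReal_mul, Complex.ofReal_pow, Complex.conj_eq_iff_re.1 (vinner_conj _ _), qc]
  have hone : (1 - qc q ^ 2 : ℂ) = ((1 - (q : ℝ) ^ 2 : ℝ) : ℂ) := by simp [qc]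
  rw [haar_star_mul, tsum_congr hterm, ← Complex.ofReal_tsum, hone, ← Complex.ofReal_mul,
    Complex.ofReal_re]
  exact mul_nonneg (one_sub_pow_nonneg q 2)
    (tsum_nonneg fun n => mul_nonneg (pow_nonneg q.2.1.le _) (vinner_self_nonneg _))

/-! ### The GNS representation -/

/-- The scalar product `(x, y) = h(x* y)` on the coordinate algebra. -/
abbrev preGNSCore (q : Param) : PreInnerProductSpace.Core ℂ (CoordAlg q) where
  inner x y := haar q (star x * y)
  conj_inner_symm := haar_star_mul_conj q
  re_inner_nonneg := haar_star_mul_self q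
  add_left x y z := by rw [star_add, add_mul, map_add]
  smul_left x y r := by rw [star_smul, smul_mul_assoc, map_smul]; rfl

/-- The coordinate algebra, regarded as a pre-Hilbert space for `(x, y) = h(x* y)`. -/
def PreGNS (q : Param) : Type := CoordAlg q

instance (q : Param) : SeminormedAddCommGroup (PreGNS q) :=
  @InnerProductSpace.Core.toSeminormedAddCommGroup ℂ (CoordAlg q) _ _ _ (preGNSCore q)

instance (q : Param) : InnerProductSpace ℂ (PreGNS q) :=
  @InnerProductSpace.ofCore ℂ (CoordAlg q) _ _ _ (preGNSCore q)

/-- The GNS Hilbert space `ℋ_h` of the Haar state. -/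
abbrev GNS (q : Param) : Type := UniformSpace.Completion (PreGNS q)

/-- The canonical map of the coordinate algebra onto a dense subspace of `ℋ_h`. -/
def gnsVec (q : Param) : CoordAlg q →ₗ[ℂ] GNS q :=
  (UniformSpace.Completion.toComplₗᵢ (𝕜 := ℂ) (E := PreGNS q)).toLinearMap

theorem gnsVec_dense (q : Param) : DenseRange (gnsVec q) :=
  UniformSpace.Completion.denseRange_coe (α := PreGNS q)

theorem gnsVec_inner (q : Param) (x y : CoordAlg q) :
    inner ℂ (gnsVec q x) (gnsVec q y) = haar q (star x * y) :=
  UniformSpace.Completion.inner_coe (𝕜 := ℂ) (E := PreGNS q) x y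

theorem gnsVec_norm_sq (q : Param) (x : CoordAlg q) :
    ‖gnsVec q x‖ ^ 2 = (haar q (star x * x)).re := by
  rw [← gnsVec_inner]; exact norm_sq_eq_re_inner (𝕜 := ℂ) _

theorem gnsVec_norm_le {q : Param} {g g' : CoordAlg q} (h : star g * g + star g' * g' = 1)
    (y : CoordAlg q) : ‖gnsVec q (g * y)‖ ≤ 1 * ‖gnsVec q y‖ := by
  rw [one_mul, ← sq_le_sq₀ (norm_nonneg _) (norm_nonneg _)]
  have h1 : ‖gnsVec q (g * y)‖ ^ 2 + ‖gnsVec q (g' * y)‖ ^ 2 = ‖gnsVec q y‖ ^ 2 := by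
    rw [gnsVec_norm_sq, gnsVec_norm_sq, gnsVec_norm_sq, ← Complex.add_re, ← map_add]
    have e : ∀ x : CoordAlg q, star (x * y) * (x * y) = star y * (star x * x) * y := fun x => by
      rw [star_mul]; simp only [mul_assoc]
    rw [e, e, ← add_mul, ← mul_add, h, mul_one]
  nlinarith [sq_nonneg ‖gnsVec q (g' * y)‖]

theorem gns_bounded (q : Param) (x : CoordAlg q) :
    ∃ C : ℝ, ∀ y, ‖gnsVec q (x * y)‖ ≤ C * ‖gnsVec q y‖ := by
  have R := isRep q
  have hq := qc_ne_zero q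
  have h1 : star (a q) * a q + star (c q) * c q = 1 := by
    rw [star_a, star_c, R.da]; simp
  have h2 : star (d q) * d q + star (b q) * b q = 1 := by
    rw [star_d, star_b, R.ad]; simp
  suffices h : ∃ C : ℝ, 0 ≤ C ∧ ∀ y, ‖gnsVec q (x * y)‖ ≤ C * ‖gnsVec q y‖ from
    let ⟨C, _, hC⟩ := h; ⟨C, hC⟩
  induction x using CoordAlg.induction with
  | scalar r =>
    refine ⟨‖r‖, norm_nonneg _, fun y => ?_⟩
    rw [← Algebra.smul_def, map_smul, norm_smul]
  | ha => exact ⟨1, zero_le_one, gnsVec_norm_le h1⟩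
  | hb => exact ⟨1, zero_le_one, gnsVec_norm_le ((add_comm _ _).trans h2)⟩
  | hc => exact ⟨1, zero_le_one, gnsVec_norm_le ((add_comm _ _).trans h1)⟩
  | hd => exact ⟨1, zero_le_one, gnsVec_norm_le h2⟩
  | add x y hx hy =>
    obtain ⟨C, hC, hx⟩ := hx
    obtain ⟨D, hD, hy⟩ := hy
    refine ⟨C + D, add_nonneg hC hD, fun v => ?_⟩
    rw [add_mul, map_add, add_mul]
    exact (norm_add_le _ _).trans (add_le_add (hx v) (hy v))
  | mul x y hx hy =>
    obtain ⟨C, hC, hx⟩ := hx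
    obtain ⟨D, hD, hy⟩ := hy
    refine ⟨C * D, mul_nonneg hC hD, fun v => ?_⟩
    rw [mul_assoc, mul_assoc]
    exact (hx _).trans (mul_le_mul_of_nonneg_left (hy v) hC)

/-- Bounded operators on `ℋ_h` that agree on the image of the coordinate algebra are equal. -/
theorem gns_ext {q : Param} {S T : GNS q →L[ℂ] GNS q}
    (h : ∀ y, S (gnsVec q y) = T (gnsVec q y)) : S = T :=
  ContinuousLinearMap.ext fun v => congrFun
    ((gnsVec_dense q).equalizer S.continuous T.continuous (funext h)) v

/-- Left multiplication by `x`, extended to a bounded operator on `ℋ_h`. -/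
def gnsOp (q : Param) (x : CoordAlg q) : GNS q →L[ℂ] GNS q :=
  (gnsVec q ∘ₗ LinearMap.mulLeft ℂ x).extendOfNorm (gnsVec q)

theorem gnsOp_apply (q : Param) (x y : CoordAlg q) :
    gnsOp q x (gnsVec q y) = gnsVec q (x * y) :=
  LinearMap.extendOfNorm_eq (gnsVec_dense q) (gns_bounded q x) y

/-- The GNS representation of the coordinate algebra on `ℋ_h`. -/
def gnsRep (q : Param) : CoordAlg q →ₐ[ℂ] (GNS q →L[ℂ] GNS q) :=
  AlgHom.ofLinearMap
    { toFun := gnsOp q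
      map_add' := fun x y => gns_ext fun z => by simp [gnsOp_apply, add_mul]
      map_smul' := fun r x => gns_ext fun z => by simp [gnsOp_apply] }
    (gns_ext fun z => by simp [gnsOp_apply])
    (fun x y => gns_ext fun z => by simp [gnsOp_apply, mul_assoc])

theorem gnsRep_apply (q : Param) (x y : CoordAlg q) :
    gnsRep q x (gnsVec q y) = gnsVec q (x * y) := gnsOp_apply q x y

/-- The Hilbert space `ℋ_h ⊕ ℋ_h`. -/
abbrev Spinors (q : Param) : Type := WithLp 2 (GNS q × GNS q)

instance (q : Param) : IsScalarTower ℂ ℂ (Spinors q →L[ℂ] Spinors q) :=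
  ⟨fun r s T => by rw [smul_eq_mul, mul_smul]⟩

/-- The operator on `ℋ_h ⊕ ℋ_h` with the given matrix entries. -/
def matOp {q : Param} (S₁₁ S₁₂ S₂₁ S₂₂ : GNS q →L[ℂ] GNS q) : Spinors q →L[ℂ] Spinors q :=
  (WithLp.prodContinuousLinearEquiv 2 ℂ (GNS q) (GNS q)).symm.toContinuousLinearMap ∘L
    ((S₁₁ ∘L ContinuousLinearMap.fst ℂ _ _ + S₁₂ ∘L ContinuousLinearMap.snd ℂ _ _).prod
      (S₂₁ ∘L ContinuousLinearMap.fst ℂ _ _ + S₂₂ ∘L ContinuousLinearMap.snd ℂ _ _)) ∘L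
    (WithLp.prodContinuousLinearEquiv 2 ℂ (GNS q) (GNS q)).toContinuousLinearMap

/-- The canonical map of `𝒜 ⊕ 𝒜` onto a dense subspace of `ℋ_h ⊕ ℋ_h`. -/
def spinorVec (q : Param) : CoordAlg q × CoordAlg q →ₗ[ℂ] Spinors q :=
  (WithLp.linearEquiv 2 ℂ (GNS q × GNS q)).symm.toLinearMap ∘ₗ (gnsVec q).prodMap (gnsVec q)

theorem spinorVec_apply (q : Param) (v : CoordAlg q × CoordAlg q) :
    spinorVec q v = WithLp.toLp 2 (gnsVec q v.1, gnsVec q v.2) := rfl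

theorem matOp_apply {q : Param} (S₁₁ S₁₂ S₂₁ S₂₂ : GNS q →L[ℂ] GNS q)
    (v : CoordAlg q × CoordAlg q) :
    matOp S₁₁ S₁₂ S₂₁ S₂₂ (spinorVec q v) = WithLp.toLp 2
      (S₁₁ (gnsVec q v.1) + S₁₂ (gnsVec q v.2), S₂₁ (gnsVec q v.1) + S₂₂ (gnsVec q v.2)) := rfl

theorem spinorVec_dense (q : Param) : DenseRange (spinorVec q) :=
  ((WithLp.prodContinuousLinearEquiv 2 ℂ (GNS q) (GNS q)).symm.surjective.denseRange).comp
    ((gnsVec_dense q).prodMap (gnsVec_dense q))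
    (WithLp.prodContinuousLinearEquiv 2 ℂ (GNS q) (GNS q)).symm.continuous

theorem spinor_ext {q : Param} {S T : Spinors q →L[ℂ] Spinors q}
    (h : ∀ v, S (spinorVec q v) = T (spinorVec q v)) : S = T :=
  ContinuousLinearMap.ext fun v => congrFun
    ((spinorVec_dense q).equalizer S.continuous T.continuous (funext h)) v

theorem matOp_diag {q : Param} (x : CoordAlg q) (v : CoordAlg q × CoordAlg q) :
    matOp (gnsRep q x) 0 0 (gnsRep q x) (spinorVec q v) = spinorVec q (x * v.1, x * v.2) := by
  rw [matOp_apply]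
  simp [spinorVec_apply, gnsRep_apply]

/-- The diagonal representation of the coordinate algebra on `ℋ_h ⊕ ℋ_h`. -/
def spinorRep (q : Param) : CoordAlg q →ₐ[ℂ] (Spinors q →L[ℂ] Spinors q) :=
  AlgHom.ofLinearMap
    { toFun := fun x => matOp (gnsRep q x) 0 0 (gnsRep q x)
      map_add' := fun x y => spinor_ext fun v => by
        simp [matOp_apply, ← WithLp.toLp_add]
      map_smul' := fun r x => spinor_ext fun v => by
        simp [matOp_apply, ← WithLp.toLp_smul] }
    (spinor_ext fun v => by
      change matOp _ _ _ _ _ = _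
      rw [matOp_apply]; simp [spinorVec_apply])
    (fun x y => spinor_ext fun v => by
      change matOp _ _ _ _ _ = matOp _ _ _ _ (matOp _ _ _ _ _)
      rw [matOp_diag, matOp_diag, matOp_diag]
      simp only [mul_assoc])

theorem spinorRep_apply (q : Param) (x : CoordAlg q) (v : CoordAlg q × CoordAlg q) :
    spinorRep q x (spinorVec q v) = spinorVec q (x * v.1, x * v.2) :=
  matOp_diag x v

/-! ### The dual pairing with `U_q(sl(2))` and the left action

The functionals `⟨kⁿ, ·⟩`, `⟨e, ·⟩`, `⟨f, ·⟩` are determined by their values on the generators and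
by `Δ(k) = k ⊗ k`, `Δ(e) = e ⊗ k + k⁻¹ ⊗ e`, `Δ(f) = f ⊗ k + k⁻¹ ⊗ f`. -/

theorem pairK_isRep (q : Param) (n : ℤ) : IsRep q (qh q ^ (-n)) 0 0 (qh q ^ n) := by
  have h := qh_ne_zero q
  constructor <;> simp [zpow_ne_zero n h]

/-- The functional `⟨kⁿ, ·⟩`: the character with `a ↦ q^{-n/2}`, `d ↦ q^{n/2}`, `b, c ↦ 0`. -/
def pairK (q : Param) (n : ℤ) : CoordAlg q →ₐ[ℂ] ℂ := lift (pairK_isRep q n)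

theorem pairE_isRep (q : Param) : IsRep q
    (!![qh q, 0; 0, (qh q)⁻¹] : Matrix (Fin 2) (Fin 2) ℂ) 0 !![0, 1; 0, 0]
    !![(qh q)⁻¹, 0; 0, qh q] := by
  have h := qh_ne_zero q
  constructor
  all_goals
    try simp only [← qh_sq]
    ext i j
    fin_cases i <;> fin_cases j <;> simp [Matrix.mul_apply, h]

theorem pairF_isRep (q : Param) : IsRep q
    (!![qh q, 0; 0, (qh q)⁻¹] : Matrix (Fin 2) (Fin 2) ℂ) !![0, 1; 0, 0] 0
    !![(qh q)⁻¹, 0; 0, qh q] := by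
  have h := qh_ne_zero q
  constructor
  all_goals
    try simp only [← qh_sq]
    ext i j
    fin_cases i <;> fin_cases j <;> simp [Matrix.mul_apply, h]

/-- The matrix `((⟨k⁻¹, x⟩, ⟨e, x⟩), (0, ⟨k, x⟩))`, multiplicative in `x`. -/
def pairEMat (q : Param) : CoordAlg q →ₐ[ℂ] Matrix (Fin 2) (Fin 2) ℂ := lift (pairE_isRep q)

/-- The matrix `((⟨k⁻¹, x⟩, ⟨f, x⟩), (0, ⟨k, x⟩))`, multiplicative in `x`. -/
def pairFMat (q : Param) : CoordAlg q →ₐ[ℂ] Matrix (Fin 2) (Fin 2) ℂ := lift (pairF_isRep q)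

/-- The functional `⟨e, ·⟩`: it has `⟨e, c⟩ = 1` and vanishes on `a, b, d`. -/
def pairE (q : Param) : CoordAlg q →ₗ[ℂ] ℂ :=
  Matrix.entryLinearMap ℂ ℂ 0 1 ∘ₗ (pairEMat q).toLinearMap

/-- The functional `⟨f, ·⟩`: it has `⟨f, b⟩ = 1` and vanishes on `a, c, d`. -/
def pairF (q : Param) : CoordAlg q →ₗ[ℂ] ℂ :=
  Matrix.entryLinearMap ℂ ℂ 0 1 ∘ₗ (pairFMat q).toLinearMap

theorem pairEMat_entries (q : Param) (x : CoordAlg q) :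
    pairEMat q x 0 0 = pairK q (-1) x ∧ pairEMat q x 1 0 = 0 ∧ pairEMat q x 1 1 = pairK q 1 x := by
  induction x using CoordAlg.induction with
  | scalar r => simp [Matrix.algebraMap_matrix_apply]
  | ha => simp [pairEMat, pairK]
  | hb => simp [pairEMat, pairK]
  | hc => simp [pairEMat, pairK]
  | hd => simp [pairEMat, pairK]
  | add x y hx hy => simp [hx, hy]
  | mul x y hx hy => simp [Matrix.mul_apply, hx, hy]

theorem pairFMat_entries (q : Param) (x : CoordAlg q) :
    pairFMat q x 0 0 = pairK q (-1) x ∧ pairFMat q x 1 0 = 0 ∧ pairFMat q x 1 1 = pairK q 1 x := by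
  induction x using CoordAlg.induction with
  | scalar r => simp [Matrix.algebraMap_matrix_apply]
  | ha => simp [pairFMat, pairK]
  | hb => simp [pairFMat, pairK]
  | hc => simp [pairFMat, pairK]
  | hd => simp [pairFMat, pairK]
  | add x y hx hy => simp [hx, hy]
  | mul x y hx hy => simp [Matrix.mul_apply, hx, hy]

/-- `⟨e, xy⟩ = ⟨e, x⟩⟨k, y⟩ + ⟨k⁻¹, x⟩⟨e, y⟩`. -/
theorem pairE_mul (q : Param) (x y : CoordAlg q) :
    pairE q (x * y) = pairE q x * pairK q 1 y + pairK q (-1) x * pairE q y := by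
  simp [pairE, Matrix.mul_apply, pairEMat_entries, add_comm]

/-- `⟨f, xy⟩ = ⟨f, x⟩⟨k, y⟩ + ⟨k⁻¹, x⟩⟨f, y⟩`. -/
theorem pairF_mul (q : Param) (x y : CoordAlg q) :
    pairF q (x * y) = pairF q x * pairK q 1 y + pairK q (-1) x * pairF q y := by
  simp [pairF, Matrix.mul_apply, pairFMat_entries, add_comm]

/-- The left action of a functional `φ`: `φ ▷ x = x₍₁₎ φ(x₍₂₎)`. -/
def act {q : Param} (φ : CoordAlg q →ₗ[ℂ] ℂ) : CoordAlg q →ₗ[ℂ] CoordAlg q :=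
  (TensorProduct.rid ℂ (CoordAlg q)).toLinearMap ∘ₗ φ.lTensor (CoordAlg q) ∘ₗ Coalgebra.comul

/-- `∂_{kⁿ} = kⁿ ▷`, an algebra endomorphism of the coordinate algebra. -/
def delK (q : Param) (n : ℤ) : CoordAlg q →ₐ[ℂ] CoordAlg q :=
  ((Algebra.TensorProduct.rid ℂ ℂ (CoordAlg q)).toAlgHom.comp
    (Algebra.TensorProduct.map (AlgHom.id ℂ (CoordAlg q)) (pairK q n))).comp
    (Bialgebra.comulAlgHom ℂ (CoordAlg q))

theorem delK_eq_act (q : Param) (n : ℤ) (x : CoordAlg q) :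
    delK q n x = act (pairK q n).toLinearMap x := rfl

/-- `∂_e = e ▷`. -/
def delE (q : Param) : CoordAlg q →ₗ[ℂ] CoordAlg q := act (pairE q)

/-- `∂_f = f ▷`. -/
def delF (q : Param) : CoordAlg q →ₗ[ℂ] CoordAlg q := act (pairF q)

/-- The automorphism `σ_L(x) = k⁻² ▷ x`. -/
def sigmaL (q : Param) : CoordAlg q →ₐ[ℂ] CoordAlg q := delK q (-2)

theorem delK_gens (q : Param) (n : ℤ) :
    delK q n (a q) = qh q ^ (-n) • a q ∧ delK q n (b q) = qh q ^ n • b q ∧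
    delK q n (c q) = qh q ^ (-n) • c q ∧ delK q n (d q) = qh q ^ n • d q := by
  have h := qh_ne_zero q
  simp [delK, comul_eq, comulHom, pairK]

theorem delE_gens (q : Param) :
    delE q (a q) = b q ∧ delE q (b q) = 0 ∧ delE q (c q) = d q ∧ delE q (d q) = 0 := by
  simp [delE, act, comul_eq, comulHom, pairE, pairEMat]

theorem delF_gens (q : Param) :
    delF q (a q) = 0 ∧ delF q (b q) = a q ∧ delF q (c q) = 0 ∧ delF q (d q) = c q := by
  simp [delF, act, comul_eq, comulHom, pairF, pairFMat]

theorem delK_delK (q : Param) (m n : ℤ) (x : CoordAlg q) :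
    delK q m (delK q n x) = delK q (m + n) x := by
  have h := qh_ne_zero q
  suffices e : (delK q m).comp (delK q n) = delK q (m + n) from DFunLike.congr_fun e x
  apply algHom_ext
  all_goals
    simp only [AlgHom.comp_apply, delK_gens, map_smul, smul_smul, ← zpow_add₀ h]
    congr 2
    ring

theorem delK_zero (q : Param) (x : CoordAlg q) : delK q 0 x = x := by
  suffices e : delK q 0 = AlgHom.id ℂ _ from DFunLike.congr_fun e x
  apply algHom_ext <;> simp [delK_gens]

theorem act_twisted_mul {q : Param} {φ : CoordAlg q →ₗ[ℂ] ℂ}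
    (h : ∀ x y, φ (x * y) = φ x * pairK q 1 y + pairK q (-1) x * φ y) (x y : CoordAlg q) :
    act φ (x * y) = act φ x * delK q 1 y + delK q (-1) x * act φ y := by
  simp only [delK_eq_act, act, LinearMap.comp_apply, Bialgebra.comul_mul]
  generalize Coalgebra.comul (R := ℂ) x = u
  generalize Coalgebra.comul (R := ℂ) y = v
  induction u using TensorProduct.induction_on with
  | zero => simp
  | add u u' hu hu' => simp only [add_mul, map_add, hu, hu']; abel
  | tmul s t =>
    induction v using TensorProduct.induction_on with
    | zero => simp
    | add v v' hv hv' => simp only [mul_add, map_add, hv, hv']; abel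
    | tmul s' t' =>
      simp [h, add_smul, smul_smul, mul_comm]

theorem delE_mul (q : Param) (x y : CoordAlg q) :
    delE q (x * y) = delE q x * delK q 1 y + delK q (-1) x * delE q y :=
  act_twisted_mul (pairE_mul q) x y

theorem delF_mul (q : Param) (x y : CoordAlg q) :
    delF q (x * y) = delF q x * delK q 1 y + delK q (-1) x * delF q y :=
  act_twisted_mul (pairF_mul q) x y

/-! ### The Dirac operator and its twisted commutators -/

/-- The Dirac operator `D_q` on its invariant domain `𝒜 ⊕ 𝒜`, dense in `ℋ_h ⊕ ℋ_h`. -/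
def dirac (q : Param) : Module.End ℂ (CoordAlg q × CoordAlg q) where
  toFun v :=
    (((qc q)⁻¹ - qc q)⁻¹ • (qc q • delK q (-2) v.1 - v.1) +
        (qh q)⁻¹ • delE q (delK q (-1) v.2),
      qh q • delF q (delK q (-1) v.1) +
        ((qc q)⁻¹ - qc q)⁻¹ • (v.2 - (qc q)⁻¹ • delK q (-2) v.2))
  map_add' v w := by
    apply Prod.ext
    all_goals
      simp only [Prod.fst_add, Prod.snd_add, map_add]
      module
  map_smul' r v := by
    apply Prod.ext
    all_goals
      simp only [Prod.smul_fst, Prod.smul_snd, map_smul, RingHom.id_apply]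
      module

theorem dirac_apply (q : Param) (v : CoordAlg q × CoordAlg q) : dirac q v =
    (((qc q)⁻¹ - qc q)⁻¹ • (qc q • delK q (-2) v.1 - v.1) +
        (qh q)⁻¹ • delE q (delK q (-1) v.2),
      qh q • delF q (delK q (-1) v.1) +
        ((qc q)⁻¹ - qc q)⁻¹ • (v.2 - (qc q)⁻¹ • delK q (-2) v.2)) := rfl

theorem delE_delK_mul (q : Param) (x y : CoordAlg q) :
    delE q (delK q (-1) (x * y)) =
      delE q (delK q (-1) x) * y + delK q (-2) x * delE q (delK q (-1) y) := by
  rw [map_mul, delE_mul, delK_delK, delK_delK]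
  norm_num [delK_zero]

theorem delF_delK_mul (q : Param) (x y : CoordAlg q) :
    delF q (delK q (-1) (x * y)) =
      delF q (delK q (-1) x) * y + delK q (-2) x * delF q (delK q (-1) y) := by
  rw [map_mul, delF_mul, delK_delK, delK_delK]
  norm_num [delK_zero]

/-- Left multiplication by `x` on `𝒜 ⊕ 𝒜`. -/
def mulCore {q : Param} (x : CoordAlg q) : Module.End ℂ (CoordAlg q × CoordAlg q) :=
  (LinearMap.mulLeft ℂ x).prodMap (LinearMap.mulLeft ℂ x)

/-- The twisted commutator `D_q x - σ_L(x) D_q` on `𝒜 ⊕ 𝒜`. -/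
def commCore (q : Param) (x : CoordAlg q) : Module.End ℂ (CoordAlg q × CoordAlg q) :=
  dirac q * mulCore x - mulCore (sigmaL q x) * dirac q

theorem commCore_apply (q : Param) (x : CoordAlg q) (v : CoordAlg q × CoordAlg q) :
    commCore q x v =
      ((((qc q)⁻¹ - qc q)⁻¹ • (delK q (-2) x - x)) * v.1 +
        ((qh q)⁻¹ • delE q (delK q (-1) x)) * v.2,
       (qh q • delF q (delK q (-1) x)) * v.1 +
        (-(((qc q)⁻¹ - qc q)⁻¹ • (delK q (-2) x - x))) * v.2) := by
  have hq := qc_ne_zero q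
  change dirac q (x * v.1, x * v.2) -
    (sigmaL q x * (dirac q v).1, sigmaL q x * (dirac q v).2) = _
  simp only [dirac_apply, delE_delK_mul, delF_delK_mul, sigmaL, map_mul (delK q (-2)),
    Prod.mk_sub_mk, mul_add, mul_sub, sub_mul, neg_mul, smul_mul_assoc, mul_smul_comm]
  apply Prod.ext
  · match_scalars <;> field_simp <;> ring
  · match_scalars <;> field_simp <;> ring

/-- The twisted commutator is bounded: it extends to `ℋ_h ⊕ ℋ_h`. -/
theorem exists_twistedComm (q : Param) (x : CoordAlg q) :
    ∃ T : Spinors q →L[ℂ] Spinors q, ∀ v, T (spinorVec q v) = spinorVec q (commCore q x v) := by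
  refine ⟨matOp (gnsRep q (((qc q)⁻¹ - qc q)⁻¹ • (delK q (-2) x - x)))
    (gnsRep q ((qh q)⁻¹ • delE q (delK q (-1) x))) (gnsRep q (qh q • delF q (delK q (-1) x)))
    (gnsRep q (-(((qc q)⁻¹ - qc q)⁻¹ • (delK q (-2) x - x)))), fun v => ?_⟩
  rw [matOp_apply, commCore_apply, spinorVec_apply]
  simp only [gnsRep_apply, map_add]

/-- The bounded operator `[D_q, x]_{σ_L} = D_q x - σ_L(x) D_q` on `ℋ_h ⊕ ℋ_h`: the continuous
extension of the twisted commutator from the dense subspace `𝒜 ⊕ 𝒜`. -/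
def twistedComm (q : Param) (x : CoordAlg q) : Spinors q →L[ℂ] Spinors q :=
  (spinorVec q ∘ₗ commCore q x).extendOfNorm (spinorVec q)

theorem twistedComm_apply (q : Param) (x : CoordAlg q) (v : CoordAlg q × CoordAlg q) :
    twistedComm q x (spinorVec q v) = spinorVec q (commCore q x v) := by
  obtain ⟨T, hT⟩ := exists_twistedComm q x
  exact LinearMap.extendOfNorm_eq (spinorVec_dense q)
    ⟨‖T‖, fun v => by rw [LinearMap.comp_apply, ← hT]; exact T.le_opNorm _⟩ v

/-- `x ↦ [D_q, x]_{σ_L}` as a linear map. -/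
def diracD (q : Param) : CoordAlg q →ₗ[ℂ] (Spinors q →L[ℂ] Spinors q) where
  toFun := twistedComm q
  map_add' x y := spinor_ext fun v => by
    rw [add_apply, twistedComm_apply, twistedComm_apply, twistedComm_apply, ← map_add]
    congr 1
    simp only [commCore_apply, Prod.mk_add_mk, map_add]
    congr 1 <;> simp only [add_mul, smul_add, sub_mul, smul_sub, neg_mul, add_sub_add_comm] <;> abel
  map_smul' r x := spinor_ext fun v => by
    rw [RingHom.id_apply, smul_apply, twistedComm_apply, twistedComm_apply, ← map_smul]
    congr 1
    simp only [commCore_apply, Prod.smul_mk, map_smul]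
    congr 1 <;> simp only [smul_add, sub_mul, smul_sub, neg_mul, smul_mul_assoc] <;> module

/-- The twisted Leibniz rule `[D, xy]_σ = σ(x) [D, y]_σ + [D, x]_σ y`. -/
theorem diracD_mul (q : Param) (x y : CoordAlg q) :
    diracD q (x * y) = spinorRep q (sigmaL q x) * diracD q y + diracD q x * spinorRep q y :=
  spinor_ext fun v => by
    change twistedComm q (x * y) _ = spinorRep q _ (twistedComm q y _) +
      twistedComm q x (spinorRep q y _)
    rw [spinorRep_apply, twistedComm_apply, twistedComm_apply, twistedComm_apply, spinorRep_apply,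
      ← map_add]
    congr 1
    have e : ∀ z w : CoordAlg q, mulCore (z * w) = mulCore z * mulCore w := fun z w =>
      LinearMap.ext fun v => by simp [mulCore]
    change commCore q (x * y) v = mulCore (sigmaL q x) (commCore q y v) + commCore q x (mulCore y v)
    simp only [commCore, map_mul, e, ← Module.End.mul_apply, ← LinearMap.add_apply]
    congr 1
    rw [sub_mul, mul_sub]
    simp only [mul_assoc]
    abel

/-! ### First-order differential calculi -/

/-- A first-order differential calculus over a complex algebra `A`: an `A`-bimodule of one-forms
with a linear map `d` that satisfies the Leibniz rule and whose one-forms `a · db` span. -/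
structure FODC (A : Type) [Ring A] [Algebra ℂ A] where
  /-- The space of one-forms. -/
  Form : Type
  [group : AddCommGroup Form]
  [module : Module ℂ Form]
  /-- The left multiplication of one-forms by elements of `A`. -/
  left : A →ₐ[ℂ] Module.End ℂ Form
  /-- The right multiplication of one-forms by elements of `A`. -/
  right : Aᵐᵒᵖ →ₐ[ℂ] Module.End ℂ Form
  left_right : ∀ (a b : A) (ω : Form),
    left a (right (MulOpposite.op b) ω) = right (MulOpposite.op b) (left a ω)
  /-- The differential. -/
  d : A →ₗ[ℂ] Form
  leibniz : ∀ a b : A, d (a * b) = left a (d b) + right (MulOpposite.op b) (d a)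
  span_eq_top : Submodule.span ℂ {ω : Form | ∃ a b : A, ω = left a (d b)} = ⊤

namespace FODC

attribute [instance] FODC.group FODC.module

variable {A : Type} [Ring A] [Algebra ℂ A]

/-- An isomorphism of first-order differential calculi: a bimodule isomorphism that intertwines
the differentials. -/
structure Iso (Γ₁ Γ₂ : FODC A) where
  /-- The underlying linear isomorphism. -/
  toEquiv : Γ₁.Form ≃ₗ[ℂ] Γ₂.Form
  map_left : ∀ (a : A) (ω : Γ₁.Form), toEquiv (Γ₁.left a ω) = Γ₂.left a (toEquiv ω)
  map_right : ∀ (a : A) (ω : Γ₁.Form),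
    toEquiv (Γ₁.right (MulOpposite.op a) ω) = Γ₂.right (MulOpposite.op a) (toEquiv ω)
  map_d : ∀ a : A, toEquiv (Γ₁.d a) = Γ₂.d a

section ofDerivation

variable {M : Type} [AddCommGroup M] [Module ℂ M]

/-- The span of the elements `a · δb` of a bimodule `M` with left multiplication `l`. -/
def formSpan (l : A →ₐ[ℂ] Module.End ℂ M) (δ : A →ₗ[ℂ] M) : Submodule ℂ M :=
  Submodule.span ℂ {m : M | ∃ a b : A, m = l a (δ b)}

theorem mem_formSpan (l : A →ₐ[ℂ] Module.End ℂ M) (δ : A →ₗ[ℂ] M) (a b : A) :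
    l a (δ b) ∈ formSpan l δ := Submodule.subset_span ⟨a, b, rfl⟩

theorem d_mem_formSpan (l : A →ₐ[ℂ] Module.End ℂ M) (δ : A →ₗ[ℂ] M) (b : A) :
    δ b ∈ formSpan l δ := by
  simpa using mem_formSpan l δ 1 b

theorem left_mem_formSpan (l : A →ₐ[ℂ] Module.End ℂ M) (δ : A →ₗ[ℂ] M) (a : A) {m : M}
    (hm : m ∈ formSpan l δ) : l a m ∈ formSpan l δ := by
  induction hm using Submodule.span_induction with
  | mem m hm =>
    obtain ⟨x, y, rfl⟩ := hm
    rw [← Module.End.mul_apply, ← map_mul]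
    exact mem_formSpan l δ _ _
  | zero => rw [map_zero]; exact Submodule.zero_mem _
  | add m m' _ _ hm hm' => rw [map_add]; exact Submodule.add_mem _ hm hm'
  | smul r m _ hm => rw [map_smul]; exact Submodule.smul_mem _ _ hm

theorem right_mem_formSpan (l : A →ₐ[ℂ] Module.End ℂ M) (r : Aᵐᵒᵖ →ₐ[ℂ] Module.End ℂ M)
    (hlr : ∀ (a b : A) (m : M), l a (r (MulOpposite.op b) m) = r (MulOpposite.op b) (l a m))
    (δ : A →ₗ[ℂ] M) (hδ : ∀ a b : A, δ (a * b) = l a (δ b) + r (MulOpposite.op b) (δ a))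
    (c : Aᵐᵒᵖ) {m : M} (hm : m ∈ formSpan l δ) : r c m ∈ formSpan l δ := by
  induction hm using Submodule.span_induction with
  | mem m hm =>
    obtain ⟨x, y, rfl⟩ := hm
    have h := hδ y c.unop
    rw [MulOpposite.op_unop] at h
    have h' := hlr x c.unop (δ y)
    rw [MulOpposite.op_unop] at h'
    rw [← h', ← sub_eq_iff_eq_add'.2 h, map_sub]
    exact Submodule.sub_mem _ (mem_formSpan l δ _ _)
      (left_mem_formSpan l δ _ (mem_formSpan l δ _ _))
  | zero => rw [map_zero]; exact Submodule.zero_mem _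
  | add m m' _ _ hm hm' => rw [map_add]; exact Submodule.add_mem _ hm hm'
  | smul r m _ hm => rw [map_smul]; exact Submodule.smul_mem _ _ hm

/-- Restriction of an action to an invariant subspace. -/
def restrictHom {B : Type} [Ring B] [Algebra ℂ B] (l : B →ₐ[ℂ] Module.End ℂ M)
    (N : Submodule ℂ M) (h : ∀ (b : B), ∀ m ∈ N, l b m ∈ N) : B →ₐ[ℂ] Module.End ℂ N :=
  AlgHom.ofLinearMap
    { toFun := fun b => (l b).restrict (h b)
      map_add' := fun b b' => by ext m; simp
      map_smul' := fun r b => by ext m; simp }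
    (by ext m; simp)
    (fun b b' => by ext m; simp)

theorem restrictHom_coe {B : Type} [Ring B] [Algebra ℂ B] (l : B →ₐ[ℂ] Module.End ℂ M)
    (N : Submodule ℂ M) (h : ∀ (b : B), ∀ m ∈ N, l b m ∈ N) (b : B) (m : N) :
    (restrictHom l N h b m : M) = l b m := rfl

/-- The calculus spanned by the elements `a · δb`, for a derivation `δ` with values in an
`A`-bimodule `M` (left multiplication `l`, right multiplication `r`). -/
def ofDerivation (l : A →ₐ[ℂ] Module.End ℂ M) (r : Aᵐᵒᵖ →ₐ[ℂ] Module.End ℂ M)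
    (hlr : ∀ (a b : A) (m : M), l a (r (MulOpposite.op b) m) = r (MulOpposite.op b) (l a m))
    (δ : A →ₗ[ℂ] M) (hδ : ∀ a b : A, δ (a * b) = l a (δ b) + r (MulOpposite.op b) (δ a)) :
    FODC A where
  Form := formSpan l δ
  left := restrictHom l _ fun a _ hm => left_mem_formSpan l δ a hm
  right := restrictHom r _ fun c _ hm => right_mem_formSpan l r hlr δ hδ c hm
  left_right a b ω := Subtype.ext (hlr a b ω)
  d := δ.codRestrict _ (d_mem_formSpan l δ)
  leibniz a b := Subtype.ext (hδ a b)
  span_eq_top := by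
    apply Submodule.map_injective_of_injective (formSpan l δ).injective_subtype
    rw [Submodule.map_span, Submodule.map_top, Submodule.range_subtype]
    refine congrArg (Submodule.span ℂ) (Set.ext fun m => ⟨?_, ?_⟩)
    · rintro ⟨_, ⟨a, b, rfl⟩, rfl⟩
      exact ⟨a, b, rfl⟩
    · rintro ⟨a, b, rfl⟩
      exact ⟨⟨_, mem_formSpan l δ a b⟩, ⟨a, b, rfl⟩, rfl⟩

end ofDerivation

/-- The linear map `a ⊗ b ↦ a · db`. -/
def mulD (Γ : FODC A) : A ⊗[ℂ] A →ₗ[ℂ] Γ.Form :=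
  TensorProduct.lift (Γ.left.toLinearMap.compl₂ Γ.d)

end FODC

namespace FODC

variable {A : Type} [Ring A] [HopfAlgebra ℂ A]

/-- A calculus over a Hopf algebra is left-covariant if
`a · db ↦ Δ(a) (id ⊗ d) Δ(b) = a₍₁₎ b₍₁₎ ⊗ a₍₂₎ · db₍₂₎` is a well-defined map `Γ → A ⊗ Γ`. -/
def IsLeftCovariant (Γ : FODC A) : Prop :=
  ∃ Φ : Γ.Form →ₗ[ℂ] A ⊗[ℂ] Γ.Form, ∀ a b : A, Φ (Γ.left a (Γ.d b)) =
    TensorProduct.map (LinearMap.mul' ℂ A) Γ.mulD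
      (TensorProduct.tensorTensorTensorComm ℂ A A A A
        (Coalgebra.comul (R := ℂ) a ⊗ₜ[ℂ] Coalgebra.comul (R := ℂ) b))

/-- The Maurer-Cartan form `ω(x) = S(x₍₁₎) · dx₍₂₎`. -/
def maurerCartan (Γ : FODC A) : A →ₗ[ℂ] Γ.Form :=
  Γ.mulD ∘ₗ (HopfAlgebra.antipode ℂ (A := A)).rTensor A ∘ₗ Coalgebra.comul

/-- The quantum tangent space: the functionals that vanish at `1` and on all `x ∈ ker ε`
with `ω(x) = 0`. -/
def quantumTangentSpace (Γ : FODC A) : Submodule ℂ (Module.Dual ℂ A) where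
  carrier := {X | X 1 = 0 ∧ ∀ x : A, Coalgebra.counit (R := ℂ) x = 0 →
    Γ.maurerCartan x = 0 → X x = 0}
  zero_mem' := ⟨rfl, fun _ _ _ => rfl⟩
  add_mem' := fun {X Y} hX hY => ⟨by simp [hX.1, hY.1], fun x h h' => by
    simp [hX.2 x h h', hY.2 x h h']⟩
  smul_mem' := fun r X hX => ⟨by simp [hX.1], fun x h h' => by simp [hX.2 x h h']⟩

end FODC

/-! ### The two calculi -/

/-- The calculus implemented by `D_q`: the span of the operators
`a · [D_q, b]_{σ_L} = σ_L(a) [D_q, b]_{σ_L}` on `ℋ_h ⊕ ℋ_h`, with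
`a · T · c = σ_L(a) T c` and `da = [D_q, a]_{σ_L}`. -/
def diracCalculus (q : Param) : FODC (CoordAlg q) :=
  FODC.ofDerivation (M := Spinors q →L[ℂ] Spinors q)
    ((Algebra.lmul ℂ (Spinors q →L[ℂ] Spinors q)).comp ((spinorRep q).comp (sigmaL q)))
    ((Algebra.lsmul ℂ ℂ (Spinors q →L[ℂ] Spinors q)).comp (AlgHom.op (spinorRep q)))
    (fun _ _ _ => (mul_assoc _ _ _).symm)
    (diracD q)
    (diracD_mul q)

/-- The differential `dx = ((k² - 1) ▷ x) ω₀ + (ek ▷ x) ω₁ + (fk ▷ x) ω₂`. -/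
def tenD (q : Param) : CoordAlg q →ₗ[ℂ] (Fin 3 → CoordAlg q) :=
  LinearMap.pi ![(delK q 2).toLinearMap - LinearMap.id, delE q ∘ₗ (delK q 1).toLinearMap,
    delF q ∘ₗ (delK q 1).toLinearMap]

theorem tenD_apply (q : Param) (x : CoordAlg q) :
    tenD q x = ![delK q 2 x - x, delE q (delK q 1 x), delF q (delK q 1 x)] := by
  ext i; fin_cases i <;> rfl

/-- Left multiplication on the free left module with basis `ω₀, ω₁, ω₂`. -/
def tenLeft (q : Param) : CoordAlg q →ₐ[ℂ] Module.End ℂ (Fin 3 → CoordAlg q) :=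
  Algebra.lsmul ℂ ℂ (Fin 3 → CoordAlg q)

/-- Right multiplication, given by `ωᵢ x = (k² ▷ x) ωᵢ`. -/
def tenRight (q : Param) : (CoordAlg q)ᵐᵒᵖ →ₐ[ℂ] Module.End ℂ (Fin 3 → CoordAlg q) :=
  (Algebra.lsmul ℂ ℂ (Fin 3 → CoordAlg q)).comp (AlgHom.op (delK q 2))

theorem tenD_mul (q : Param) (x y : CoordAlg q) :
    tenD q (x * y) = tenLeft q x (tenD q y) + tenRight q (MulOpposite.op y) (tenD q x) := by
  have h0 : delK q 2 (x * y) - x * y = x * (delK q 2 y - y) + (delK q 2 x - x) * delK q 2 y := by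
    rw [map_mul]; noncomm_ring
  have h1 : delE q (delK q 1 (x * y)) =
      x * delE q (delK q 1 y) + delE q (delK q 1 x) * delK q 2 y := by
    rw [map_mul, delE_mul, delK_delK, delK_delK, add_comm]; norm_num [delK_zero]
  have h2 : delF q (delK q 1 (x * y)) =
      x * delF q (delK q 1 y) + delF q (delK q 1 x) * delK q 2 y := by
    rw [map_mul, delF_mul, delK_delK, delK_delK, add_comm]; norm_num [delK_zero]
  rw [tenD_apply, tenD_apply, tenD_apply, h0, h1, h2]
  ext i; fin_cases i <;> rfl

theorem ten_span (q : Param) : Submodule.span ℂ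
    {ω : Fin 3 → CoordAlg q | ∃ x y, ω = tenLeft q x (tenD q y)} = ⊤ := by
  have R := isRep q
  have hq := qc_ne_zero q
  have hh := qh_ne_zero q
  set N : Submodule ℂ (Fin 3 → CoordAlg q) := FODC.formSpan (tenLeft q) (tenD q) with hN
  change N = ⊤
  have hmem : ∀ x y : CoordAlg q, tenLeft q x (tenD q y) ∈ N := FODC.mem_formSpan _ _
  have hl : ∀ (x : CoordAlg q) (ω : Fin 3 → CoordAlg q), tenLeft q x ω = fun i => x * ω i :=
    fun _ _ => rfl
  have da : tenD q (a q) = ![((qc q)⁻¹ - 1) • a q, (qh q)⁻¹ • b q, 0] := by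
    rw [tenD_apply]
    simp [delK_gens, delE_gens, delF_gens, sub_smul, ← qh_sq, zpow_neg, zpow_ofNat, pow_two]
  have db : tenD q (b q) = ![(qc q - 1) • b q, 0, qh q • a q] := by
    rw [tenD_apply]
    simp [delK_gens, delE_gens, delF_gens, sub_smul, ← qh_sq, zpow_ofNat, pow_two]
  have dc : tenD q (c q) = ![((qc q)⁻¹ - 1) • c q, (qh q)⁻¹ • d q, 0] := by
    rw [tenD_apply]
    simp [delK_gens, delE_gens, delF_gens, sub_smul, ← qh_sq, zpow_neg, zpow_ofNat, pow_two]
  have dd : tenD q (d q) = ![(qc q - 1) • d q, 0, qh q • c q] := by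
    rw [tenD_apply]
    simp [delK_gens, delE_gens, delF_gens, sub_smul, ← qh_sq, zpow_ofNat, pow_two]
  have e0 : (![1, 0, 0] : Fin 3 → CoordAlg q) = ((qc q)⁻¹ - 1)⁻¹ •
      (tenLeft q (d q) (tenD q (a q)) - (qc q)⁻¹ • tenLeft q (b q) (tenD q (c q))) := by
    have h1 : (qc q)⁻¹ - 1 ≠ 0 := by
      rw [sub_ne_zero, ne_eq, inv_eq_one, qc, Complex.ofReal_eq_one]
      exact q.2.2.ne
    rw [da, dc, hl, hl]
    ext i
    fin_cases i
    · simp [R.da, smul_smul, h1, mul_comm, smul_add]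
    · have h2 : (qc q)⁻¹ * ((qh q)⁻¹ * qc q) = (qh q)⁻¹ := by field_simp
      simp [R.bd, smul_smul, h2]
    · simp
  have e1 : (![0, 1, 0] : Fin 3 → CoordAlg q) = qh q •
      (tenLeft q (a q) (tenD q (c q)) - qc q • tenLeft q (c q) (tenD q (a q))) := by
    rw [da, dc, hl, hl]
    ext i
    fin_cases i
    · simp [R.ac, smul_smul, mul_comm]
    · simp [R.ad, smul_smul, hh, mul_comm, smul_add]
    · simp
  have e2 : (![0, 0, 1] : Fin 3 → CoordAlg q) = (qh q)⁻¹ •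
      (tenLeft q (d q) (tenD q (b q)) - (qc q)⁻¹ • tenLeft q (b q) (tenD q (d q))) := by
    rw [db, dd, hl, hl]
    ext i
    fin_cases i
    · simp [R.bd, smul_smul, mul_comm, hq]
    · simp
    · simp [R.da, smul_smul, hh, mul_comm, smul_add]
  have m0 : (![1, 0, 0] : Fin 3 → CoordAlg q) ∈ N := by
    rw [e0]
    exact N.smul_mem _ (N.sub_mem (hmem _ _) (N.smul_mem _ (hmem _ _)))
  have m1 : (![0, 1, 0] : Fin 3 → CoordAlg q) ∈ N := by
    rw [e1]
    exact N.smul_mem _ (N.sub_mem (hmem _ _) (N.smul_mem _ (hmem _ _)))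
  have m2 : (![0, 0, 1] : Fin 3 → CoordAlg q) ∈ N := by
    rw [e2]
    exact N.smul_mem _ (N.sub_mem (hmem _ _) (N.smul_mem _ (hmem _ _)))
  rw [eq_top_iff]
  intro ω _
  have key : ω = tenLeft q (ω 0) ![1, 0, 0] + tenLeft q (ω 1) ![0, 1, 0] +
      tenLeft q (ω 2) ![0, 0, 1] := by
    rw [hl, hl, hl]
    ext i
    fin_cases i <;> simp
  rw [key]
  exact N.add_mem (N.add_mem (FODC.left_mem_formSpan _ _ _ m0) (FODC.left_mem_formSpan _ _ _ m1))
    (FODC.left_mem_formSpan _ _ _ m2)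

/-- Number 10 in Heckenberger's list: the free left module with basis `ω₀, ω₁, ω₂`, right
multiplication `ωᵢ x = (k² ▷ x) ωᵢ` and differential
`dx = ((k² - 1) ▷ x) ω₀ + (ek ▷ x) ω₁ + (fk ▷ x) ω₂`. -/
def heckenberger10 (q : Param) : FODC (CoordAlg q) where
  Form := Fin 3 → CoordAlg q
  left := tenLeft q
  right := tenRight q
  left_right x y ω := by ext i; exact (mul_assoc _ _ _).symm
  d := tenD q
  leibniz := tenD_mul q
  span_eq_top := ten_span q

/-- The functionals `⟨k² - 1, ·⟩`, `⟨ek, ·⟩`, `⟨fk, ·⟩`. -/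
def tenTangent (q : Param) : Fin 3 → Module.Dual ℂ (CoordAlg q) :=
  ![(pairK q 2).toLinearMap - Coalgebra.counit, pairE q ∘ₗ (delK q 1).toLinearMap,
    pairF q ∘ₗ (delK q 1).toLinearMap]

end QuantumSU2

end

/-!
The calculus `Γ₁₀` is governed by the three functionals `X₀ = k² - 1`, `X₁ = ek`, `X₂ = fk`: its
differential is `dx = ∑ᵢ (Xᵢ ▷ x) ωᵢ` (`tenD_apply_eq_act`). The left action by a functional
commutes with the coproduct, `Δ(φ ▷ x) = x₍₁₎ ⊗ φ ▷ x₍₂₎` (`comul_act`), so that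
`∑ᵢ xᵢ ωᵢ ↦ ∑ᵢ Δ(xᵢ) (1 ⊗ ωᵢ)` is a left coaction with the required values on `a · db`. The same
identity and the antipode axiom give `S(x₍₁₎) dx₍₂₎ = ∑ᵢ Xᵢ(x) ωᵢ`. Hence the quantum tangent
space consists of the functionals that vanish at `1` and on the common kernel of `ε, X₀, X₁, X₂`,
which is the span of the `Xᵢ`, since these vanish at `1` while `ε(1) = 1`. Linear independence is
seen by evaluation at `a, c, b`.

For the comparison with `D_q`, the commutation rules of `k⁻²` with `e` and `f` show that
`[D_q, x]_{σ_L}` is the matrix with entries proportional to `σ_L(Xᵢ ▷ x)`. Sending `ωᵢ` to a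
constant `2 × 2` matrix and coefficients `x` to `σ_L(x)` thus defines a bimodule map `spinorForm`
from `Γ₁₀` to the bounded operators on `ℋ_h ⊕ ℋ_h` that carries `d` to `d_{σ_L}`, and its range is
`Ω¹_{D_q}`. It is injective as soon as `𝒜 → ℋ_h` is, that is, as soon as the Haar state is
faithful on `𝒜`.

Faithfulness (`haar_faithful`): `h(x* x) = 0` forces `x e_{n,0} = 0` for all `n`, because
`h(x* x)` is a series of nonnegative terms with positive weights. The algebra is spanned by the
monomials `a ^ N b ^ j c ^ k` and `d ^ N b ^ j c ^ k` (`span_monomial`), and such a monomial maps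
`e_{n,0}` to `e_{n∓N,k-j}` up to the scalar `(-q) ^ j (q ^ n) ^ (j + k)` and a factor that depends
on `N` and `n` only and is nonzero for large `n`. For fixed `N` and `k - j`, the coefficients of
`x` are therefore, up to nonzero factors, those of a polynomial that vanishes at `q ^ n` for all
large `n` (`eq_zero_of_rep_bvec`).
-/

namespace QuantumSU2

open CoordAlg

/-! ### A spanning set of monomials -/

/-- The power `a ^ N` for `N ≥ 0` and `d ^ (-N)` for `N < 0`. -/
noncomputable def diagPow (q : Param) : ℤ → CoordAlg q
  | .ofNat i => a q ^ i
  | .negSucc i => d q ^ (i + 1)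

/-- The monomial `a ^ N b ^ j c ^ k` (`N ≥ 0`) or `d ^ (-N) b ^ j c ^ k` (`N < 0`), indexed by
`(N, j, k)`. -/
noncomputable def monomial (q : Param) (p : ℤ × ℕ × ℕ) : CoordAlg q :=
  diagPow q p.1 * (b q ^ p.2.1 * c q ^ p.2.2)

theorem mul_pow_eq_smul {q : Param} {x y : CoordAlg q} {r : ℂ} (h : x * y = r • (y * x))
    (i : ℕ) : x * y ^ i = r ^ i • (y ^ i * x) := by
  induction i with
  | zero => simp
  | succ i ih =>
    rw [pow_succ, ← mul_assoc, ih, smul_mul_assoc, mul_assoc, h, mul_smul_comm, smul_smul,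
      ← mul_assoc, pow_succ]

theorem exists_mul_diagPow (q : Param) {x : CoordAlg q} (ha : ∃ r : ℂ, x * a q = r • (a q * x))
    (hd : ∃ r : ℂ, x * d q = r • (d q * x)) (N : ℤ) :
    ∃ r : ℂ, x * diagPow q N = r • (diagPow q N * x) := by
  obtain ⟨r, hr⟩ := ha
  obtain ⟨s, hs⟩ := hd
  cases N with
  | ofNat i => exact ⟨_, mul_pow_eq_smul hr i⟩
  | negSucc i => exact ⟨_, mul_pow_eq_smul hs (i + 1)⟩

theorem b_mul_diagPow (q : Param) (N : ℤ) : ∃ r : ℂ, b q * diagPow q N = r • (diagPow q N * b q) :=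
  exists_mul_diagPow q ⟨(qc q)⁻¹, by simp [(isRep q).ab, smul_smul, qc_ne_zero q]⟩
    ⟨qc q, (isRep q).bd⟩ N

theorem c_mul_diagPow (q : Param) (N : ℤ) : ∃ r : ℂ, c q * diagPow q N = r • (diagPow q N * c q) :=
  exists_mul_diagPow q ⟨(qc q)⁻¹, by simp [(isRep q).ac, smul_smul, qc_ne_zero q]⟩
    ⟨qc q, (isRep q).cd⟩ N

theorem b_mul_monomial (q : Param) (p : ℤ × ℕ × ℕ) :
    ∃ r : ℂ, b q * monomial q p = r • monomial q (p.1, p.2.1 + 1, p.2.2) := by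
  obtain ⟨r, hr⟩ := b_mul_diagPow q p.1
  exact ⟨r, by rw [monomial, ← mul_assoc, hr, smul_mul_assoc, monomial, pow_succ']
               simp only [mul_assoc]⟩

theorem c_mul_monomial (q : Param) (p : ℤ × ℕ × ℕ) :
    ∃ r : ℂ, c q * monomial q p = r • monomial q (p.1, p.2.1, p.2.2 + 1) := by
  obtain ⟨r, hr⟩ := c_mul_diagPow q p.1
  have hcb : Commute (c q) (b q) := (isRep q).bc.symm
  have hc := hcb.pow_right p.2.1
  refine ⟨r, ?_⟩
  rw [monomial, ← mul_assoc, hr, smul_mul_assoc, monomial, mul_assoc, ← mul_assoc (c q), hc.eq,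
    pow_succ', mul_assoc]

/-- The monomials `a ^ i b ^ j c ^ k` and `d ^ i b ^ j c ^ k` span the coordinate algebra. -/
theorem span_monomial (q : Param) : Submodule.span ℂ (Set.range (monomial q)) = ⊤ := by
  set W := Submodule.span ℂ (Set.range (monomial q)) with hW
  have mem : ∀ p, monomial q p ∈ W := fun p => Submodule.subset_span ⟨p, rfl⟩
  have ext : ∀ x : CoordAlg q, (∀ p, x * monomial q p ∈ W) → ∀ w ∈ W, x * w ∈ W := by
    intro x h w hw
    have : W ≤ W.comap (LinearMap.mulLeft ℂ x) :=
      Submodule.span_le.2 (by rintro _ ⟨p, rfl⟩; exact h p)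
    exact this hw
  have hb : ∀ w ∈ W, b q * w ∈ W := ext _ fun p => by
    obtain ⟨r, hr⟩ := b_mul_monomial q p
    rw [hr]; exact W.smul_mem _ (mem _)
  have hc : ∀ w ∈ W, c q * w ∈ W := ext _ fun p => by
    obtain ⟨r, hr⟩ := c_mul_monomial q p
    rw [hr]; exact W.smul_mem _ (mem _)
  have ha : ∀ w ∈ W, a q * w ∈ W := ext _ fun ⟨N, j, k⟩ => by
    have low : ∀ i : ℕ, a q * (d q ^ (i + 1) * (b q ^ j * c q ^ k)) =
        d q ^ i * (b q ^ j * c q ^ k) + qc q • (c q * (b q * (d q ^ i * (b q ^ j * c q ^ k)))) := by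
      intro i
      rw [pow_succ', ← mul_assoc, ← mul_assoc (a q), (isRep q).ad]
      simp only [add_mul, one_mul, smul_mul_assoc, mul_assoc]
    cases N with
    | ofNat i =>
      have e : a q * monomial q (.ofNat i, j, k) = monomial q (.ofNat (i + 1), j, k) := by
        simp only [monomial, diagPow, pow_succ', mul_assoc]
      rw [e]; exact mem _
    | negSucc i =>
      have m : d q ^ i * (b q ^ j * c q ^ k) ∈ W := by
        cases i with
        | zero => simpa [monomial, diagPow] using mem (.ofNat 0, j, k)
        | succ i => exact mem (.negSucc i, j, k)
      rw [monomial, diagPow, low]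
      exact W.add_mem m (W.smul_mem _ (hc _ (hb _ m)))
  have hd : ∀ w ∈ W, d q * w ∈ W := ext _ fun ⟨N, j, k⟩ => by
    have low : ∀ i : ℕ, d q * (a q ^ (i + 1) * (b q ^ j * c q ^ k)) =
        a q ^ i * (b q ^ j * c q ^ k) +
          (qc q)⁻¹ • (b q * (c q * (a q ^ i * (b q ^ j * c q ^ k)))) := by
      intro i
      rw [pow_succ', ← mul_assoc, ← mul_assoc (d q), (isRep q).da]
      simp only [add_mul, one_mul, smul_mul_assoc, mul_assoc]
    rcases N with (_ | i) | i
    · have e : d q * monomial q (.ofNat 0, j, k) = monomial q (.negSucc 0, j, k) := by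
        simp [monomial, diagPow]
      exact e ▸ mem _
    · rw [monomial, diagPow, low]
      have m : a q ^ i * (b q ^ j * c q ^ k) ∈ W := mem (.ofNat i, j, k)
      exact W.add_mem m (W.smul_mem _ (hb _ (hc _ m)))
    · have e : d q * monomial q (.negSucc i, j, k) = monomial q (.negSucc (i + 1), j, k) := by
        simp only [monomial, diagPow, pow_succ' _ (i + 1), mul_assoc]
      rw [e]; exact mem _
  have h1 : (1 : CoordAlg q) ∈ W := by simpa [monomial, diagPow] using mem (.ofNat 0, 0, 0)
  have key : ∀ x : CoordAlg q, ∀ w ∈ W, x * w ∈ W := by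
    intro x
    induction x using CoordAlg.induction with
    | scalar r => intro w hw; rw [← Algebra.smul_def]; exact W.smul_mem _ hw
    | ha => exact ha
    | hb => exact hb
    | hc => exact hc
    | hd => exact hd
    | add x y hx hy => intro w hw; rw [add_mul]; exact W.add_mem (hx w hw) (hy w hw)
    | mul x y hx hy => intro w hw; rw [mul_assoc]; exact hx _ (hy w hw)
  rw [eq_top_iff]
  intro x _
  simpa using key x 1 h1

/-! ### Faithfulness of the Haar state -/

/-- The scalar by which `a ^ N` (`N ≥ 0`) or `d ^ (-N)` (`N < 0`) maps `e_{n,m}` to a multiple of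
`e_{n-N,m}`. -/
noncomputable def diagWeight (q : Param) : ℤ → ℕ → ℂ
  | .ofNat i, n => ∏ l ∈ Finset.range i, rt q (2 * (n - l))
  | .negSucc i, n => ∏ l ∈ Finset.range (i + 1), rt q (2 * (n + l + 1))

theorem rt_ne_zero (q : Param) {n : ℕ} (hn : n ≠ 0) : rt q n ≠ 0 := by
  have h : (q : ℝ) ^ n < 1 := pow_lt_one₀ q.2.1.le q.2.2 hn
  rw [rt, Complex.ofReal_ne_zero]
  exact (Real.sqrt_pos.2 (sub_pos.2 h)).ne'

theorem diagWeight_ne_zero (q : Param) {N : ℤ} {n : ℕ} (h : N ≤ n) : diagWeight q N n ≠ 0 := by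
  cases N with
  | ofNat i =>
    have h' : i ≤ n := Int.ofNat_le.1 h
    refine Finset.prod_ne_zero_iff.2 fun l hl => rt_ne_zero q ?_
    have := Finset.mem_range.1 hl
    omega
  | negSucc i => exact Finset.prod_ne_zero_iff.2 fun l _ => rt_ne_zero q (by omega)

theorem diagWeight_eq_zero (q : Param) {N : ℤ} {n : ℕ} (h : (n : ℤ) < N) :
    diagWeight q N n = 0 := by
  cases N with
  | ofNat i =>
    have h' : n < i := Int.ofNat_lt.1 h
    exact Finset.prod_eq_zero (Finset.mem_range.2 h') (by simp [rt_zero])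
  | negSucc i => omega

theorem opA_pow_bvec (q : Param) (i n : ℕ) (m : ℤ) : (opA q ^ i) (bvec n m) =
    (∏ l ∈ Finset.range i, rt q (2 * (n - l))) • bvec (n - i) m := by
  induction i with
  | zero => simp
  | succ i ih =>
    rw [pow_succ', Module.End.mul_apply, ih, map_smul, opA, shiftOp_bvec, smul_smul,
      Finset.prod_range_succ]
    rfl

theorem opD_pow_bvec (q : Param) (i n : ℕ) (m : ℤ) : (opD q ^ i) (bvec n m) =
    (∏ l ∈ Finset.range i, rt q (2 * (n + l + 1))) • bvec (n + i) m := by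
  induction i with
  | zero => simp
  | succ i ih =>
    rw [pow_succ', Module.End.mul_apply, ih, map_smul, opD_bvec, smul_smul,
      Finset.prod_range_succ]
    rfl

theorem opB_pow_bvec (q : Param) (j n : ℕ) (m : ℤ) : (opB q ^ j) (bvec n m) =
    (-qc q ^ (n + 1)) ^ j • bvec n (m - j) := by
  induction j with
  | zero => simp
  | succ j ih =>
    rw [pow_succ', Module.End.mul_apply, ih, map_smul, opB_bvec, smul_smul, ← pow_succ]
    congr 2
    push_cast; ring

theorem opC_pow_bvec (q : Param) (k n : ℕ) (m : ℤ) : (opC q ^ k) (bvec n m) =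
    (qc q ^ n) ^ k • bvec n (m + k) := by
  induction k with
  | zero => simp
  | succ k ih =>
    rw [pow_succ', Module.End.mul_apply, ih, map_smul, opC_bvec, smul_smul, ← pow_succ]
    congr 2
    push_cast; ring

theorem rep_diagPow_bvec (q : Param) (N : ℤ) (n : ℕ) (m : ℤ) :
    rep q (diagPow q N) (bvec n m) = diagWeight q N n • bvec (n - N).toNat m := by
  cases N with
  | ofNat i =>
    have e : ((n : ℤ) - Int.ofNat i).toNat = n - i := by simp
    rw [diagPow, map_pow, e]
    simp only [rep, lift_a]
    exact opA_pow_bvec q i n m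
  | negSucc i =>
    have e : ((n : ℤ) - Int.negSucc i).toNat = n + (i + 1) := by omega
    rw [diagPow, map_pow, e]
    simp only [rep, lift_d]
    exact opD_pow_bvec q (i + 1) n m

theorem rep_monomial_bvec (q : Param) (p : ℤ × ℕ × ℕ) (n : ℕ) :
    rep q (monomial q p) (bvec n 0) =
      (diagWeight q p.1 n * ((-qc q) ^ p.2.1 * (qc q ^ n) ^ (p.2.1 + p.2.2))) •
        bvec (n - p.1).toNat (p.2.2 - p.2.1) := by
  obtain ⟨N, j, k⟩ := p
  have hB : rep q (b q) = opB q := by simp [rep]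
  have hC : rep q (c q) = opC q := by simp [rep]
  rw [monomial, map_mul, map_mul, map_pow, map_pow, hB, hC, Module.End.mul_apply,
    Module.End.mul_apply, opC_pow_bvec, map_smul, opB_pow_bvec, smul_smul, map_smul,
    rep_diagPow_bvec, smul_smul, zero_add]
  congr 1
  rw [pow_succ']
  simp only [← neg_mul, mul_pow, pow_add]
  ring

theorem qc_pow_injective (q : Param) : Function.Injective fun n : ℕ => qc q ^ n := by
  intro m n h
  have h' : (q : ℝ) ^ m = (q : ℝ) ^ n := by
    simp only [qc] at h
    exact_mod_cast h
  exact (pow_right_strictAnti₀ q.2.1 q.2.2).injective h'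

/-- An element of the coordinate algebra whose image in the representation kills all vectors
`e_{n,0}` is zero. For fixed `N` and `k - j`, the coefficients of the monomials
`a ^ N b ^ j c ^ k` (with `d ^ (-N)` in place of `a ^ N` if `N < 0`) are, up to nonzero
factors, those of a polynomial with roots `q ^ n` for all large `n`. -/
theorem eq_zero_of_rep_bvec (q : Param) (x : CoordAlg q)
    (h : ∀ n, rep q x (bvec n 0) = 0) : x = 0 := by
  have hx : x ∈ Submodule.span ℂ (Set.range (monomial q)) := span_monomial q ▸ Submodule.mem_top
  obtain ⟨l, rfl⟩ := Finsupp.mem_span_range_iff_exists_finsupp.1 hx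
  suffices hl : l = 0 by simp [hl]
  ext ⟨N, j, k⟩
  set S := l.support.filter fun p => p.1 = N ∧ (p.2.2 : ℤ) - p.2.1 = k - j with hS
  set P : Polynomial ℂ := ∑ p ∈ S, Polynomial.monomial (p.2.1 + p.2.2) (l p * (-qc q) ^ p.2.1)
    with hP
  have root : ∀ n : ℕ, N ≤ n → P.eval (qc q ^ n) = 0 := by
    intro n hn
    have h1 := DFunLike.congr_fun (h n) ((n - N).toNat, (k : ℤ) - j)
    rw [Finsupp.sum, map_sum, LinearMap.sum_apply, Finsupp.finsetSum_apply] at h1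
    have h2 : ∀ p ∈ l.support, (rep q (l p • monomial q p) (bvec n 0))
        ((n - N).toNat, (k : ℤ) - j) = if p.1 = N ∧ (p.2.2 : ℤ) - p.2.1 = k - j then
          diagWeight q N n * (l p * (-qc q) ^ p.2.1 * (qc q ^ n) ^ (p.2.1 + p.2.2)) else 0 := by
      intro p _
      rw [map_smul, LinearMap.smul_apply, rep_monomial_bvec, bvec, Finsupp.smul_apply,
        Finsupp.smul_apply, Finsupp.single_apply, smul_eq_mul, smul_eq_mul]
      split_ifs with h3 h4 h4
      · rw [h4.1]; ring
      · -- the two vectors can only coincide for `p.1 ≠ N` when `a ^ p.1` kills `e_{n,0}`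
        rw [Prod.mk.injEq] at h3
        have : (n : ℤ) < p.1 := by
          by_contra hlt
          exact h4 ⟨by omega, h3.2⟩
        rw [diagWeight_eq_zero q this]; ring
      · exact absurd (by rw [h4.1, h4.2]) h3
      · simp
    rw [Finset.sum_congr rfl h2, ← Finset.sum_filter, ← Finset.mul_sum] at h1
    have h3 := (mul_eq_zero.1 h1).resolve_left (diagWeight_ne_zero q hn)
    rw [hP, Polynomial.eval_finsetSum, ← h3]
    exact Finset.sum_congr rfl fun p _ => Polynomial.eval_monomial
  have hP0 : P = 0 := by
    refine Polynomial.eq_zero_of_infinite_isRoot P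
      (((Set.Ici_infinite N.toNat).image (qc_pow_injective q).injOn).mono ?_)
    rintro _ ⟨n, hn, rfl⟩
    exact root n (by have := Set.mem_Ici.1 hn; omega)
  by_contra hne
  have hcoeff := congrArg (fun P => P.coeff (j + k)) hP0
  simp only [hP, Polynomial.finsetSum_coeff, Polynomial.coeff_monomial, Polynomial.coeff_zero]
    at hcoeff
  rw [Finset.sum_eq_single (N, j, k)] at hcoeff
  · simp only [if_true, mul_eq_zero, pow_eq_zero_iff', neg_eq_zero, qc_ne_zero, false_and,
      or_false] at hcoeff
    exact hne hcoeff
  · rintro ⟨N', j', k'⟩ hp hpne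
    rw [if_neg]
    intro hsum
    obtain ⟨rfl, hdiff⟩ := (Finset.mem_filter.1 hp).2
    apply hpne
    simp only at hsum hdiff
    ext <;> simp <;> omega
  · intro hn
    rw [Finset.mem_filter, not_and] at hn
    exact absurd ⟨rfl, rfl⟩ (hn (Finsupp.mem_support_iff.2 hne))

theorem eq_zero_of_vinner_self {u : Vec} (h : (vinner u u).re = 0) : u = 0 := by
  rw [vinner, Finsupp.sum, Complex.re_sum] at h
  have hre : ∀ z : ℂ, ((starRingEnd ℂ) z * z).re = Complex.normSq z := fun z => by
    rw [← Complex.normSq_eq_conj_mul_self, Complex.ofReal_re]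
  simp only [hre] at h
  rw [Finset.sum_eq_zero_iff_of_nonneg fun _ _ => Complex.normSq_nonneg _] at h
  ext p
  by_cases hp : p ∈ u.support
  · simpa using h p hp
  · simpa using hp

/-- The Haar state is faithful on the coordinate algebra. -/
theorem haar_faithful (q : Param) {x : CoordAlg q} (h : (haar q (star x * x)).re = 0) : x = 0 := by
  set r : ℕ → ℝ := fun n =>
    (q : ℝ) ^ (2 * n) * (vinner (rep q x (bvec n 0)) (rep q x (bvec n 0))).re with hr
  have hterm : ∀ n : ℕ, qc q ^ (2 * n) * rep q (star x * x) (bvec n 0) (n, 0) = (r n : ℂ) := by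
    intro n
    rw [hr, map_mul, Module.End.mul_apply, ← vinner_bvec_left]
    conv_lhs => rw [← vinner_conj, rep_star, vinner_conj]
    rw [Complex.ofReal_mul, Complex.ofReal_pow, Complex.conj_eq_iff_re.1 (vinner_conj _ _), qc]
  have hsum : Summable r := by
    have := haar_summable q (star x * x)
    simp only [hterm] at this
    exact Complex.summable_ofReal.1 this
  have hnonneg : ∀ n, 0 ≤ r n := fun n =>
    mul_nonneg (pow_nonneg q.2.1.le _) (vinner_self_nonneg _)
  have hval : haar q (star x * x) = (((1 - (q : ℝ) ^ 2) * ∑' n, r n : ℝ) : ℂ) := by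
    change (1 - qc q ^ 2) * _ = _
    rw [tsum_congr hterm, ← Complex.ofReal_tsum]
    simp [qc]
  rw [hval, Complex.ofReal_re] at h
  have hq : 1 - (q : ℝ) ^ 2 ≠ 0 := (sub_pos.2 (pow_lt_one₀ q.2.1.le q.2.2 two_ne_zero)).ne'
  have h0 := (mul_eq_zero.1 h).resolve_left hq
  have hr0 : r = 0 := (hasSum_zero_iff_of_nonneg hnonneg).1 (h0 ▸ hsum.hasSum)
  refine eq_zero_of_rep_bvec q x fun n => eq_zero_of_vinner_self ?_
  have := congrFun hr0 n
  exact (mul_eq_zero.1 this).resolve_left (pow_ne_zero _ q.2.1.ne')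

theorem gnsVec_injective (q : Param) : Function.Injective (gnsVec q) :=
  (injective_iff_map_eq_zero _).2 fun x hx => haar_faithful q <| by
    rw [← gnsVec_norm_sq, hx, norm_zero]; simp

/-! ### Functionals and the left action -/

/-- The left action by a functional is a map of left comodules:
`Δ(φ ▷ x) = x₍₁₎ ⊗ φ ▷ x₍₂₎`. -/
theorem comul_act {q : Param} (φ : CoordAlg q →ₗ[ℂ] ℂ) (x : CoordAlg q) :
    Coalgebra.comul (R := ℂ) (act φ x) =
      (act φ).lTensor (CoordAlg q) (Coalgebra.comul (R := ℂ) x) := by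
  have key : ∀ u : CoordAlg q ⊗[ℂ] CoordAlg q,
      Coalgebra.comul (R := ℂ) (TensorProduct.rid ℂ (CoordAlg q) (φ.lTensor _ u)) =
        (TensorProduct.rid ℂ (CoordAlg q)).toLinearMap.lTensor _ ((φ.lTensor _).lTensor _
          (TensorProduct.assoc ℂ _ _ _ ((Coalgebra.comul (R := ℂ)).rTensor _ u))) := by
    intro u
    induction u using TensorProduct.induction_on with
    | zero => simp
    | add u v hu hv => simp only [map_add, hu, hv]
    | tmul s t =>
      simp only [LinearMap.lTensor_tmul, LinearMap.rTensor_tmul, TensorProduct.rid_tmul, map_smul]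
      generalize Coalgebra.comul (R := ℂ) s = w
      induction w using TensorProduct.induction_on with
      | zero => simp
      | add u v hu hv => simp only [TensorProduct.add_tmul, map_add, smul_add, hu, hv]
      | tmul s₁ s₂ => simp
  rw [act, LinearMap.lTensor_comp, LinearMap.lTensor_comp]
  simp only [LinearMap.comp_apply]
  rw [← Coalgebra.coassoc_apply]
  exact key _

theorem act_act {q : Param} (φ ψ : CoordAlg q →ₗ[ℂ] ℂ) (x : CoordAlg q) :
    act φ (act ψ x) = act (φ ∘ₗ act ψ) x := by
  conv_lhs => rw [act]
  simp only [LinearMap.comp_apply]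
  rw [comul_act, ← LinearMap.lTensor_comp_apply]
  rfl

theorem act_counit {q : Param} (x : CoordAlg q) : act Coalgebra.counit x = x := by
  simp [act]

theorem counit_act {q : Param} (φ : CoordAlg q →ₗ[ℂ] ℂ) (x : CoordAlg q) :
    Coalgebra.counit (R := ℂ) (act φ x) = φ x := by
  have key : ∀ u : CoordAlg q ⊗[ℂ] CoordAlg q,
      Coalgebra.counit (R := ℂ) (TensorProduct.rid ℂ (CoordAlg q) (φ.lTensor _ u)) =
        φ (TensorProduct.lid ℂ (CoordAlg q) ((Coalgebra.counit (R := ℂ)).rTensor _ u)) := by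
    intro u
    induction u using TensorProduct.induction_on with
    | zero => simp
    | add u v hu hv => simp only [map_add, hu, hv]
    | tmul s t => simp [mul_comm]
  refine (key (Coalgebra.comul x)).trans ?_
  simp

/-- `S(x₍₁₎) (φ ▷ x₍₂₎) = φ(x) 1`. -/
theorem antipode_mul_act {q : Param} (φ : CoordAlg q →ₗ[ℂ] ℂ) (x : CoordAlg q) :
    LinearMap.mul' ℂ _ ((HopfAlgebra.antipode ℂ (A := CoordAlg q)).rTensor _
      ((act φ).lTensor _ (Coalgebra.comul (R := ℂ) x))) = algebraMap ℂ _ (φ x) := by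
  rw [← comul_act, HopfAlgebra.mul_antipode_rTensor_comul_apply, counit_act]

/-- The components of the differential are the left actions of the functionals
`k² - 1`, `ek`, `fk`. -/
theorem tenD_apply_eq_act (q : Param) (x : CoordAlg q) (i : Fin 3) :
    tenD q x i = act (tenTangent q i) x := by
  rw [tenD_apply]
  fin_cases i
  · change delK q 2 x - x = act ((pairK q 2).toLinearMap - Coalgebra.counit) x
    have h : act ((pairK q 2).toLinearMap - Coalgebra.counit) x =
        act (pairK q 2).toLinearMap x - act Coalgebra.counit x := by
      simp [act, LinearMap.lTensor_sub]
    rw [h, act_counit, delK_eq_act]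
  · exact act_act (pairE q) (pairK q 1).toLinearMap x
  · exact act_act (pairF q) (pairK q 1).toLinearMap x

/-! ### Left-covariance and the quantum tangent space -/

theorem heckenberger10_isLeftCovariant (q : Param) : (heckenberger10 q).IsLeftCovariant := by
  have h : ∀ x y i, Coalgebra.comul (R := ℂ) (tenLeft q x (tenD q y) i) =
      Coalgebra.comul (R := ℂ) x *
        (act (tenTangent q i)).lTensor _ (Coalgebra.comul (R := ℂ) y) := by
    intro x y i
    rw [← comul_act, ← tenD_apply_eq_act, ← Bialgebra.comul_mul]
    rfl
  let μ : CoordAlg q ⊗[ℂ] CoordAlg q →ₗ[ℂ] (Fin 3 → CoordAlg q) := (heckenberger10 q).mulD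
  have hμ : ∀ t t', μ (t ⊗ₜ t') = ∑ i, LinearMap.single ℂ (fun _ : Fin 3 => CoordAlg q) i
      (t * act (tenTangent q i) t') := by
    intro t t'
    simp only [← tenD_apply_eq_act]
    exact (Finset.univ_sum_single (fun i => t * tenD q t' i)).symm
  have key : ∀ u v : CoordAlg q ⊗[ℂ] CoordAlg q,
      ∑ i, (LinearMap.single ℂ (fun _ : Fin 3 => CoordAlg q) i).lTensor (CoordAlg q)
        (u * (act (tenTangent q i)).lTensor _ v) =
      TensorProduct.map (LinearMap.mul' ℂ (CoordAlg q)) μ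
        (TensorProduct.tensorTensorTensorComm ℂ _ _ _ _ (u ⊗ₜ[ℂ] v)) := by
    intro u v
    induction u using TensorProduct.induction_on with
    | zero => simp
    | add u u' hu hu' =>
      simp only [add_mul, map_add, Finset.sum_add_distrib, hu, hu', TensorProduct.add_tmul]
    | tmul s t =>
      induction v using TensorProduct.induction_on with
      | zero => simp
      | add v v' hv hv' =>
        simp only [mul_add, map_add, Finset.sum_add_distrib, hv, hv', TensorProduct.tmul_add]
      | tmul s' t' =>
        simp only [LinearMap.lTensor_tmul, Algebra.TensorProduct.tmul_mul_tmul,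
          TensorProduct.tensorTensorTensorComm_tmul, TensorProduct.map_tmul, LinearMap.mul'_apply,
          hμ, TensorProduct.tmul_sum]
  refine ⟨∑ i, (LinearMap.single ℂ (fun _ : Fin 3 => CoordAlg q) i).lTensor (CoordAlg q) ∘ₗ
    Coalgebra.comul ∘ₗ LinearMap.proj i, fun x y => ?_⟩
  refine (LinearMap.sum_apply _ _ _).trans ?_
  exact (Finset.sum_congr rfl fun i _ => congrArg _ (h x y i)).trans (key _ _)

theorem heckenberger10_maurerCartan (q : Param) (x : CoordAlg q) :
    (heckenberger10 q).maurerCartan x = fun i => algebraMap ℂ (CoordAlg q) (tenTangent q i x) := by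
  funext i
  rw [← antipode_mul_act]
  change (heckenberger10 q).mulD (((HopfAlgebra.antipode ℂ (A := CoordAlg q)).rTensor _)
    (Coalgebra.comul (R := ℂ) x)) i = _
  generalize Coalgebra.comul (R := ℂ) x = u
  induction u using TensorProduct.induction_on with
  | zero => simp only [map_zero]; rfl
  | add u v hu hv => simp only [map_add, ← hu, ← hv]; rfl
  | tmul s t =>
    simp only [LinearMap.lTensor_tmul, LinearMap.rTensor_tmul, LinearMap.mul'_apply,
      ← tenD_apply_eq_act]
    rfl

theorem tenTangent_one (q : Param) (i : Fin 3) : tenTangent q i 1 = 0 := by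
  fin_cases i
  · simp [tenTangent]
  · simp [tenTangent, pairE]
  · simp [tenTangent, pairF]

theorem algebraMap_coordAlg_injective (q : Param) :
    Function.Injective (algebraMap ℂ (CoordAlg q)) :=
  Function.LeftInverse.injective (g := counitHom q) fun r => (counitHom q).commutes r

theorem heckenberger10_maurerCartan_eq_zero_iff (q : Param) (x : CoordAlg q) :
    (heckenberger10 q).maurerCartan x = 0 ↔ ∀ i, tenTangent q i x = 0 := by
  rw [heckenberger10_maurerCartan]
  refine funext_iff.trans (forall_congr' fun i => ?_)
  exact map_eq_zero_iff _ (algebraMap_coordAlg_injective q)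

theorem heckenberger10_quantumTangentSpace (q : Param) :
    (heckenberger10 q).quantumTangentSpace = Submodule.span ℂ (Set.range (tenTangent q)) := by
  apply le_antisymm
  · rintro X ⟨hX1, hX⟩
    -- `X` vanishes on the common kernel of `ε` and the three functionals, hence is a linear
    -- combination of them, and the coefficient of `ε` is `X 1 = 0`
    have hker : X ∈ Submodule.span ℂ (Set.range fun o : Option (Fin 3) =>
        o.elim (Coalgebra.counit (R := ℂ) (A := CoordAlg q)) (tenTangent q)) := by
      refine mem_span_of_iInf_ker_le_ker fun x hx => ?_
      rw [Submodule.mem_iInf] at hx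
      exact hX x (hx none) ((heckenberger10_maurerCartan_eq_zero_iff q x).2 fun i => hx (some i))
    obtain ⟨w, hw⟩ := (Submodule.mem_span_range_iff_exists_fun ℂ).1 hker
    rw [Fintype.sum_option] at hw
    have h1 := LinearMap.congr_fun hw 1
    have hw0 : w none = 0 := by
      simpa [hX1, tenTangent_one] using h1
    rw [← hw, hw0]
    simp only [zero_smul, zero_add]
    exact Submodule.sum_mem _ fun i _ => Submodule.smul_mem _ _ (Submodule.subset_span ⟨i, rfl⟩)
  · refine Submodule.span_le.2 ?_
    rintro _ ⟨i, rfl⟩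
    exact ⟨tenTangent_one q i, fun x _ hx =>
      (heckenberger10_maurerCartan_eq_zero_iff q x).1 hx i⟩

theorem qc_ne_one (q : Param) : qc q ≠ 1 := by
  rw [qc, ne_eq, Complex.ofReal_eq_one]
  exact q.2.2.ne

theorem linearIndependent_tenTangent (q : Param) : LinearIndependent ℂ (tenTangent q) := by
  have hh := qh_ne_zero q
  have h1 : (qc q)⁻¹ - 1 ≠ 0 := sub_ne_zero.2 (inv_eq_one.not.2 (qc_ne_one q))
  have ha : ∀ i, tenTangent q i (a q) = ![(qc q)⁻¹ - 1, 0, 0] i := by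
    intro i
    fin_cases i <;>
    simp [tenTangent, pairK, pairE, pairEMat, pairF, pairFMat, delK_gens, counit_eq, counitHom,
      ← qh_sq, zpow_neg, zpow_ofNat, pow_two]
  have hc : ∀ i, tenTangent q i (c q) = ![0, (qh q)⁻¹, 0] i := by
    intro i
    fin_cases i <;>
    simp [tenTangent, pairK, pairE, pairEMat, pairF, pairFMat, delK_gens, counit_eq, counitHom]
  have hb : ∀ i, tenTangent q i (b q) = ![0, 0, qh q] i := by
    intro i
    fin_cases i <;>
    simp [tenTangent, pairK, pairE, pairEMat, pairF, pairFMat, delK_gens, counit_eq, counitHom]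
  rw [Fintype.linearIndependent_iff]
  intro g hg
  have eval : ∀ x, ∑ i, g i * tenTangent q i x = 0 := fun x => by
    simpa using LinearMap.congr_fun hg x
  have ea := eval (a q)
  have eb := eval (b q)
  have ec := eval (c q)
  simp only [ha, hb, hc, Fin.sum_univ_three] at ea eb ec
  simp at ea eb ec
  intro i
  fin_cases i
  · exact ea.resolve_right h1
  · exact ec.resolve_right hh
  · exact eb.resolve_right hh

/-! ### Isomorphisms of calculi -/

namespace FODC

variable {A : Type} [Ring A]

/-- A calculus is isomorphic to the calculus of a derivation with values in a bimodule `M` as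
soon as it embeds in `M` compatibly with the bimodule structures and the differentials. -/
theorem nonempty_iso_ofDerivation [Algebra ℂ A] {M : Type} [AddCommGroup M] [Module ℂ M]
    (l : A →ₐ[ℂ] Module.End ℂ M) (r : Aᵐᵒᵖ →ₐ[ℂ] Module.End ℂ M)
    (hlr : ∀ (a b : A) (m : M), l a (r (MulOpposite.op b) m) = r (MulOpposite.op b) (l a m))
    (δ : A →ₗ[ℂ] M) (hδ : ∀ a b : A, δ (a * b) = l a (δ b) + r (MulOpposite.op b) (δ a))
    (Γ : FODC A) (T : Γ.Form →ₗ[ℂ] M) (hT : Function.Injective T)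
    (hl : ∀ a ω, T (Γ.left a ω) = l a (T ω))
    (hr : ∀ a ω, T (Γ.right (MulOpposite.op a) ω) = r (MulOpposite.op a) (T ω))
    (hd : ∀ a, T (Γ.d a) = δ a) : Nonempty (Iso (ofDerivation l r hlr δ hδ) Γ) := by
  have hrange : LinearMap.range T = formSpan l δ := by
    rw [LinearMap.range_eq_map, ← Γ.span_eq_top, Submodule.map_span, formSpan]
    congr 1
    ext m
    constructor
    · rintro ⟨_, ⟨a, b, rfl⟩, rfl⟩
      exact ⟨a, b, by rw [hl, hd]⟩
    · rintro ⟨a, b, rfl⟩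
      exact ⟨_, ⟨a, b, rfl⟩, by rw [hl, hd]⟩
  let e : Γ.Form ≃ₗ[ℂ] formSpan l δ :=
    (LinearEquiv.ofInjective T hT).trans (LinearEquiv.ofEq _ _ hrange)
  have he : ∀ m : formSpan l δ, T (e.symm m) = m := fun m =>
    congrArg Subtype.val (e.apply_symm_apply m)
  refine ⟨⟨e.symm, fun a ω => ?_, fun a ω => ?_, fun a => ?_⟩⟩
  · exact e.symm_apply_eq.2 (Subtype.ext ((congrArg (l a) (he ω)).symm.trans (hl a _).symm))
  · exact e.symm_apply_eq.2
      (Subtype.ext ((congrArg (r (MulOpposite.op a)) (he ω)).symm.trans (hr a _).symm))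
  · exact e.symm_apply_eq.2 (Subtype.ext (hd a).symm)

theorem IsLeftCovariant.of_iso [HopfAlgebra ℂ A] {Γ₁ Γ₂ : FODC A} (e : Iso Γ₁ Γ₂)
    (h : Γ₂.IsLeftCovariant) : Γ₁.IsLeftCovariant := by
  obtain ⟨Φ, hΦ⟩ := h
  have hmul : Γ₁.mulD = e.toEquiv.symm.toLinearMap ∘ₗ Γ₂.mulD := by
    ext a b
    refine e.toEquiv.injective ?_
    change e.toEquiv (Γ₁.left a (Γ₁.d b)) = e.toEquiv (e.toEquiv.symm (Γ₂.left a (Γ₂.d b)))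
    rw [e.toEquiv.apply_symm_apply, e.map_left, e.map_d]
  refine ⟨e.toEquiv.symm.toLinearMap.lTensor A ∘ₗ Φ ∘ₗ e.toEquiv.toLinearMap, fun a b => ?_⟩
  have h1 : (e.toEquiv.symm.toLinearMap.lTensor A ∘ₗ Φ ∘ₗ e.toEquiv.toLinearMap)
      (Γ₁.left a (Γ₁.d b)) = e.toEquiv.symm.toLinearMap.lTensor A (Φ (Γ₂.left a (Γ₂.d b))) := by
    rw [← e.map_d, ← e.map_left]; rfl
  rw [h1, hΦ, hmul, LinearMap.lTensor, ← LinearMap.comp_apply, ← TensorProduct.map_comp,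
    LinearMap.id_comp]

end FODC

/-! ### The representation of one-forms on spinors -/

theorem delK_delE (q : Param) (n : ℤ) (x : CoordAlg q) :
    delK q n (delE q x) = qh q ^ (2 * n) • delE q (delK q n x) := by
  have h := qh_ne_zero q
  have e : qh q ^ (2 * n) * (qh q ^ n)⁻¹ = qh q ^ n := by
    rw [← zpow_neg, ← zpow_add₀ h]; congr 1; ring
  induction x using CoordAlg.induction with
  | scalar r =>
    simp [Algebra.algebraMap_eq_smul_one, delE, act, pairE, Algebra.TensorProduct.one_def]
  | ha => simp [delE_gens, delK_gens, smul_smul, e]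
  | hb => simp [delE_gens, delK_gens]
  | hc => simp [delE_gens, delK_gens, smul_smul, e]
  | hd => simp [delE_gens, delK_gens]
  | add x y hx hy => simp only [map_add, hx, hy, smul_add]
  | mul x y hx hy =>
    rw [delE_mul, map_add, map_mul, map_mul, hx, hy, map_mul, delE_mul, smul_add, smul_mul_assoc,
      mul_smul_comm]
    simp only [delK_delK, add_comm n]

theorem delK_delF (q : Param) (n : ℤ) (x : CoordAlg q) :
    delK q n (delF q x) = qh q ^ (-2 * n) • delF q (delK q n x) := by
  have h := qh_ne_zero q
  have e : qh q ^ (-2 * n) * qh q ^ n = qh q ^ (-n) := by rw [← zpow_add₀ h]; congr 1; ring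
  induction x using CoordAlg.induction with
  | scalar r =>
    simp [Algebra.algebraMap_eq_smul_one, delF, act, pairF, Algebra.TensorProduct.one_def]
  | ha => simp [delF_gens, delK_gens]
  | hb =>
    rw [(delF_gens q).2.1, (delK_gens q n).1, (delK_gens q n).2.1]
    simp [delF_gens, smul_smul, ← e]
  | hc => simp [delF_gens, delK_gens]
  | hd =>
    rw [(delF_gens q).2.2.2, (delK_gens q n).2.2.1, (delK_gens q n).2.2.2]
    simp [delF_gens, smul_smul, ← e]
  | add x y hx hy => simp only [map_add, hx, hy, smul_add]
  | mul x y hx hy =>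
    rw [delF_mul, map_add, map_mul, map_mul, hx, hy, map_mul, delF_mul, smul_add, smul_mul_assoc,
      mul_smul_comm]
    simp only [delK_delK, add_comm n]

theorem sigmaL_injective (q : Param) : Function.Injective (sigmaL q) :=
  Function.LeftInverse.injective (g := delK q 2) fun x => by
    rw [sigmaL, delK_delK]; exact delK_zero q x

theorem sigmaL_delK_two (q : Param) (x : CoordAlg q) : sigmaL q (delK q 2 x) = x := by
  rw [sigmaL, delK_delK]; exact delK_zero q x

theorem sigmaL_tenD_one (q : Param) (x : CoordAlg q) :
    qc q ^ 2 • sigmaL q (delE q (delK q 1 x)) = delE q (delK q (-1) x) := by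
  rw [sigmaL, delK_delE, delK_delK, smul_smul, ← qh_sq]
  have h := qh_ne_zero q
  have e : (qh q * qh q) ^ 2 * qh q ^ (2 * (-2) : ℤ) = 1 := by
    norm_num [zpow_neg, zpow_ofNat]; field_simp
  rw [e, one_smul]; rfl

theorem sigmaL_tenD_two (q : Param) (x : CoordAlg q) :
    (qc q ^ 2)⁻¹ • sigmaL q (delF q (delK q 1 x)) = delF q (delK q (-1) x) := by
  rw [sigmaL, delK_delF, delK_delK, smul_smul, ← qh_sq]
  have h := qh_ne_zero q
  have e : ((qh q * qh q) ^ 2)⁻¹ * qh q ^ (-2 * (-2) : ℤ) = 1 := by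
    norm_num [zpow_ofNat]; field_simp
  rw [e, one_smul]; rfl

/-- The bounded operator on `ℋ_h ⊕ ℋ_h` representing the one-form `x₀ ω₀ + x₁ ω₁ + x₂ ω₂`: the
basis is represented by the constant matrices `(q⁻¹ - q)⁻¹ diag(-1, 1)`, `q^{-1/2} q² E₁₂`,
`q^{1/2} q⁻² E₂₁`, and the coefficient `xᵢ` by left multiplication by `σ_L(xᵢ)`. The factors
`q^{±2}` are those by which `k⁻²` commutes past `e` and `f`. -/
noncomputable def spinorForm (q : Param) :
    (Fin 3 → CoordAlg q) →ₗ[ℂ] (Spinors q →L[ℂ] Spinors q) where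
  toFun ω := matOp (gnsRep q (-(((qc q)⁻¹ - qc q)⁻¹ • sigmaL q (ω 0))))
    (gnsRep q (((qh q)⁻¹ * qc q ^ 2) • sigmaL q (ω 1)))
    (gnsRep q ((qh q * (qc q ^ 2)⁻¹) • sigmaL q (ω 2)))
    (gnsRep q (((qc q)⁻¹ - qc q)⁻¹ • sigmaL q (ω 0)))
  map_add' ω η := spinor_ext fun v => by
    rw [add_apply, matOp_apply, matOp_apply, matOp_apply, ← WithLp.toLp_add]
    simp only [Pi.add_apply, map_add, map_smul, map_neg, add_apply, smul_apply, neg_apply,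
      Prod.mk_add_mk]
    congr 2 <;> module
  map_smul' r ω := spinor_ext fun v => by
    rw [RingHom.id_apply, smul_apply, matOp_apply, matOp_apply, ← WithLp.toLp_smul]
    simp only [Pi.smul_apply, map_smul, map_neg, smul_apply, neg_apply, Prod.smul_mk]
    congr 2 <;> module

theorem spinorForm_apply (q : Param) (ω : Fin 3 → CoordAlg q) (v : CoordAlg q × CoordAlg q) :
    spinorForm q ω (spinorVec q v) = spinorVec q
      (-(((qc q)⁻¹ - qc q)⁻¹ • sigmaL q (ω 0)) * v.1 +
        (((qh q)⁻¹ * qc q ^ 2) • sigmaL q (ω 1)) * v.2,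
       ((qh q * (qc q ^ 2)⁻¹) • sigmaL q (ω 2)) * v.1 +
        (((qc q)⁻¹ - qc q)⁻¹ • sigmaL q (ω 0)) * v.2) := by
  refine (matOp_apply _ _ _ _ v).trans ?_
  rw [spinorVec_apply]
  simp only [gnsRep_apply, map_add]

theorem spinorVec_injective (q : Param) : Function.Injective (spinorVec q) := by
  intro v w h
  have h' := congrArg WithLp.ofLp h
  exact Prod.ext (gnsVec_injective q (congrArg Prod.fst h'))
    (gnsVec_injective q (congrArg Prod.snd h'))

/-- The basis forms are represented by linearly independent matrices, and the coordinate algebra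
acts faithfully on `ℋ_h`. -/
theorem spinorForm_injective (q : Param) : Function.Injective (spinorForm q) := by
  have hq := qc_ne_zero q
  have hh := qh_ne_zero q
  have hs : (qc q)⁻¹ - qc q ≠ 0 := by
    have h0 : (0 : ℝ) < q := q.2.1
    have h1 : (q : ℝ) < (q : ℝ)⁻¹ := q.2.2.trans ((one_lt_inv₀ h0).2 q.2.2)
    rw [qc, ← Complex.ofReal_inv, ← Complex.ofReal_sub, Complex.ofReal_ne_zero]
    exact (sub_pos.2 h1).ne'
  refine (injective_iff_map_eq_zero _).2 fun ω hω => ?_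
  have h : ∀ v, spinorForm q ω (spinorVec q v) = spinorVec q 0 := fun v => by
    rw [hω, map_zero]; rfl
  have h1 := spinorVec_injective q ((spinorForm_apply q ω (1, 0)).symm.trans (h _))
  have h2 := spinorVec_injective q ((spinorForm_apply q ω (0, 1)).symm.trans (h _))
  have hσ : ∀ i, sigmaL q (ω i) = 0 → ω i = 0 := fun i =>
    (map_eq_zero_iff _ (sigmaL_injective q)).1
  simp [hh, hq, hs] at h1 h2
  funext i
  fin_cases i
  · exact hσ 0 h1.1
  · exact hσ 1 h2.1
  · exact hσ 2 h1.2

theorem spinorForm_left (q : Param) (x : CoordAlg q) (ω : Fin 3 → CoordAlg q) :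
    spinorForm q (tenLeft q x ω) = spinorRep q (sigmaL q x) * spinorForm q ω :=
  spinor_ext fun v => by
    change _ = spinorRep q (sigmaL q x) (spinorForm q ω (spinorVec q v))
    rw [spinorForm_apply, spinorForm_apply, spinorRep_apply]
    have e : ∀ i, tenLeft q x ω i = x * ω i := fun _ => rfl
    simp only [e, map_mul, mul_add, neg_mul, mul_neg, smul_mul_assoc, mul_smul_comm, mul_assoc]

theorem spinorForm_right (q : Param) (x : CoordAlg q) (ω : Fin 3 → CoordAlg q) :
    spinorForm q (tenRight q (MulOpposite.op x) ω) = spinorForm q ω * spinorRep q x :=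
  spinor_ext fun v => by
    change _ = spinorForm q ω (spinorRep q x (spinorVec q v))
    rw [spinorRep_apply, spinorForm_apply, spinorForm_apply]
    have e : ∀ i, tenRight q (MulOpposite.op x) ω i = ω i * delK q 2 x := fun _ => rfl
    simp only [e, map_mul, sigmaL_delK_two, neg_mul, smul_mul_assoc, mul_assoc]

theorem spinorForm_tenD (q : Param) (x : CoordAlg q) : spinorForm q (tenD q x) = diracD q x :=
  spinor_ext fun v => by
    change _ = twistedComm q x (spinorVec q v)
    rw [twistedComm_apply, spinorForm_apply, commCore_apply, tenD_apply]
    have e0 : sigmaL q (delK q 2 x - x) = -(delK q (-2) x - x) := by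
      rw [map_sub, sigmaL_delK_two, sigmaL, neg_sub]
    change spinorVec q
      (-(((qc q)⁻¹ - qc q)⁻¹ • sigmaL q (delK q 2 x - x)) * v.1 +
        (((qh q)⁻¹ * qc q ^ 2) • sigmaL q (delE q (delK q 1 x))) * v.2,
       ((qh q * (qc q ^ 2)⁻¹) • sigmaL q (delF q (delK q 1 x))) * v.1 +
        (((qc q)⁻¹ - qc q)⁻¹ • sigmaL q (delK q 2 x - x)) * v.2) = _
    rw [e0, mul_smul, mul_smul, sigmaL_tenD_one, sigmaL_tenD_two, smul_neg, neg_neg]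

theorem nonempty_iso_diracCalculus (q : Param) :
    Nonempty (FODC.Iso (diracCalculus q) (heckenberger10 q)) :=
  FODC.nonempty_iso_ofDerivation _ _ _ _ _ (heckenberger10 q) (spinorForm q)
    (spinorForm_injective q) (spinorForm_left q) (spinorForm_right q) (spinorForm_tenD q)

end QuantumSU2

theorem mainTheorem6 (q : Set.Ioo (0 : ℝ) 1) :
    (QuantumSU2.heckenberger10 q).IsLeftCovariant ∧
    (QuantumSU2.heckenberger10 q).quantumTangentSpace =
      Submodule.span ℂ (Set.range (QuantumSU2.tenTangent q)) ∧
    LinearIndependent ℂ (QuantumSU2.tenTangent q) ∧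
    (QuantumSU2.diracCalculus q).IsLeftCovariant ∧
    Nonempty (QuantumSU2.FODC.Iso (QuantumSU2.diracCalculus q) (QuantumSU2.heckenberger10 q)) :=
  ⟨QuantumSU2.heckenberger10_isLeftCovariant q, QuantumSU2.heckenberger10_quantumTangentSpace q,
    QuantumSU2.linearIndependent_tenTangent q,
    (QuantumSU2.nonempty_iso_diracCalculus q).elim fun e =>
      .of_iso e (QuantumSU2.heckenberger10_isLeftCovariant q),
    QuantumSU2.nonempty_iso_diracCalculus q⟩
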